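/- Setting. Let $d,M,K\ge 1$ and $n\ge 0$ be integers with $2^n\mid M$, and let $\delta>0$. Let $e^{i\theta_{mk}(\omega)}$ ($1\le m\le M$, $1\le k\le K$, $1\le\omega\le d$) be i.i.d. random phases (complex numbers of modulus one) with zero mean, with an arbitrary such distribution, and let $|\psi_{mk}\rangle=d^{-1/2}\sum_{\omega=1}^d e^{i\theta_{mk}(\omega)}|\omega\rangle\in\mathbb C^d$ be the corresponding random codewords; $m$ is the message and $k$ the secret key, both uniform. A leak of $n$ bits of the message is a function $L:\{1,\dots,M\}\to\{0,1\}^n$ such that every value $v$ is taken by exactly $M2^{-n}$ messages. If Eve learns that $L(m)=v$, the message is uniform on $S=L^{-1}(v)$, and her correlations with it are described by $$\rho_{AE}^{S}=\frac1{|S|}\sum_{m\in S}|m\rangle\langle m|\otimes\frac1K\sum_{k=1}^K|\psi_{mk}\rangle\langle\psi_{mk}| .$$ Her accessible information $I_{\rm acc}(S)$, in bits, is the supremum over all local (finite-outcome) measurements on $A$ and $E$ of the mutual information $H(X)+H(Y)-H(X,Y)$ of the outcomes. Write $\log=\log_2$. Robustness against message leakage. There are absolute constants $C,c>0$ such that,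 for all parameters as above, the probability $p_{\rm fail}$ (over the choice of the codewords) that there exist a leak $L$ of $n$ bits and a value $v$ of these bits with $$I_{\rm acc}(L^{-1}(v))> C\,\delta\,(\log M-n)$$ satisfies $$p_{\rm fail}\le\exp\Big\{-M2^{-n}\Big[\frac{\delta^3K}{4}-\ln M-\delta(\ln M-n)-2^{n+1}\frac dM\ln\frac5\delta\Big]\Big\},$$ and if $$K>K_n:=\frac4{\delta^3}\Big[\ln M+\delta(\ln M-n)+2^{n+1}\frac dM\ln\frac5\delta\Big],$$ then moreover $p_{\rm fail}\le e^{-c\,M2^{-n}}$, which for any given $n$ is exponentially small in $M$. That is, with high probability, whichever $n$ bits of the message leak, Eve's accessible information about the remaining $\log M-n$ bits is $O(\delta(\log M-n))$. Size of the key. Let $K_{\rm base}:=\frac4{\delta^2}\big(\ln M+\frac{2d}{\delta M}\ln\frac5\delta\big)$ be the lower bound on $K$ required without leakage. The key has to be enlarged by about $n$ bits, in the following sense: for $0<\delta<5$ (so that $\ln(5/\delta)>0$), $$K_n\le 2^n\Big(1+\frac1\delta\Big)K_{\rm base}\qquad\text{and}\qquad\Big|\frac{K_n}{2^nK_{\rm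 base}}-1\Big|\le\frac{(1+2\delta)\,M\ln M}{2d\ln(5/\delta)} .$$ -/

import Mathlib

open MeasureTheory ProbabilityTheory
open scoped Kronecker Matrix ComplexOrder

noncomputable section

namespace QDL

/-- A (finite-outcome) positive operator-valued measurement on the Hilbert space `ℂ^ι`,
with outcomes in `X`. -/
structure POVM (ι X : Type*) [Fintype ι] [DecidableEq ι] [Fintype X] where
  elem : X → Matrix ι ι ℂ
  posSemidef : ∀ x, (elem x).PosSemidef
  sum_elem : ∑ x, elem x = 1

/-- Shannon entropy, in bits. -/
def entropy {X : Type*} [Fintype X] (p : X → ℝ) : ℝ :=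
  ∑ x, -(p x * Real.logb 2 (p x))

/-- Classical mutual information `H(X) + H(Y) - H(X,Y)` of a joint distribution, in bits. -/
def mutualInfo {X Y : Type*} [Fintype X] [Fintype Y] (p : X × Y → ℝ) : ℝ :=
  entropy (fun x => ∑ y, p (x, y)) + entropy (fun y => ∑ x, p (x, y)) - entropy p

/-- Joint outcome distribution (Born rule) of local measurements on the two subsystems of a
bipartite state `ρ`. -/
def outcomeDist {ι κ X Y : Type*} [Fintype ι] [DecidableEq ι] [Fintype κ] [DecidableEq κ]
    [Fintype X] [Fintype Y] (ρ : Matrix (ι × κ) (ι × κ) ℂ) (P : POVM ι X) (Q : POVM κ Y) :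
    X × Y → ℝ :=
  fun xy => (((P.elem xy.1 ⊗ₖ Q.elem xy.2) * ρ).trace).re

/-- Accessible information of a bipartite state, in bits: the supremum, over all local measurements
on the two subsystems, of the mutual information of the outcomes. (It takes values in `EReal`
so that no boundedness is presupposed by the supremum.) -/
def accInfo {ι κ : Type*} [Fintype ι] [DecidableEq ι] [Fintype κ] [DecidableEq κ]
    (ρ : Matrix (ι × κ) (ι × κ) ℂ) : EReal :=
  ⨆ (a : ℕ) (b : ℕ) (P : POVM ι (Fin a)) (Q : POVM κ (Fin b)),
    ((mutualInfo (outcomeDist ρ P Q) : ℝ) : EReal)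

/-- The vector `d^{-1/2} ∑_ω z(ω) |ω⟩` given by `d` phases `z(ω) = e^{iθ(ω)}`. -/
def phaseVector {d : ℕ} (z : Fin d → ℂ) : Fin d → ℂ :=
  fun ω => (1 / (Real.sqrt d : ℂ)) * z ω

/-- The classical-quantum state
`ρ_AE = |S|⁻¹ ∑_{m ∈ S} |m⟩⟨m| ⊗ K⁻¹ ∑_k |ψ_{mk}⟩⟨ψ_{mk}|`
of a message that is uniform on `S` and of the system intercepted by Eve, who does not know the
key `k`. Here `ψ m k` is the codeword for message `m` and key `k`. -/
def cqState {M K d : ℕ} (ψ : Fin M → Fin K → Fin d → ℂ) (S : Finset (Fin M)) :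
    Matrix ({m // m ∈ S} × Fin d) ({m // m ∈ S} × Fin d) ℂ :=
  (1 / (S.card : ℂ)) • ∑ m : {m // m ∈ S},
    (Matrix.single m m (1 : ℂ)) ⊗ₖ
      ((1 / (K : ℂ)) • ∑ k : Fin K, Matrix.vecMulVec (ψ m k) (star (ψ m k)))

/-- The random phases `z(m,k,ω) = e^{iθ_{mk}(ω)}` are complex numbers of modulus one, i.i.d.
with zero mean, so that the codewords are sampled i.i.d. from the phase ensemble. -/
structure IsPhaseEnsemble {Ω : Type*} [MeasurableSpace Ω] (μ : Measure Ω) {M K d : ℕ}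
    (z : Fin M × Fin K × Fin d → Ω → ℂ) : Prop where
  norm_eq_one : ∀ i x, ‖z i x‖ = 1
  measurable : ∀ i, Measurable (z i)
  indep : iIndepFun z μ
  identDistrib : ∀ i j, IdentDistrib (z i) (z j) μ μ
  mean_zero : ∀ i, ∫ x, z i x ∂μ = 0

/-- The codewords `ψ_{mk}` at the sample point `x`. -/
def codeword {Ω : Type*} {M K d : ℕ} (z : Fin M × Fin K × Fin d → Ω → ℂ) (x : Ω) :
    Fin M → Fin K → Fin d → ℂ :=
  fun m k => phaseVector (fun ω => z (m, k, ω) x)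

/-- `L m` is the value of `n` leaked bits of the message `m`: for every value `v` of these bits,
`M 2^{-n}` of the `M` messages remain possible. -/
def IsBitLeak {M n : ℕ} (L : Fin M → Fin n → Bool) : Prop :=
  ∀ v : Fin n → Bool, (Finset.univ.filter fun m => L m = v).card * 2 ^ n = M

/-- The event that, for some `n` bits of the message and some value of these bits, Eve, who knows
this value, has more than `B` bits of accessible information about the message (which is
then uniform on the `M 2^{-n}` messages that remain possible). -/
def leakFailure {Ω : Type*} {M K d : ℕ} (z : Fin M × Fin K × Fin d → Ω → ℂ) (n : ℕ) (B : ℝ) :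
    Set Ω :=
  {x | ∃ L : Fin M → Fin n → Bool, IsBitLeak L ∧ ∃ v : Fin n → Bool,
    (B : EReal) < accInfo (cqState (codeword z x) (Finset.univ.filter fun m => L m = v))}

/-- Lower bound on the key size `K` without leakage. -/
def keyBound (d M : ℕ) (δ : ℝ) : ℝ :=
  4 / δ ^ 2 * (Real.log M + 2 * d / (δ * M) * Real.log (5 / δ))

/-- Lower bound on the key size `K` when `n` bits of the message leak. -/
def leakKeyBound (d M n : ℕ) (δ : ℝ) : ℝ :=
  4 / δ ^ 3 * (Real.log M + δ * (Real.log M - n) + 2 ^ (n + 1) * (d / M) * Real.log (5 / δ))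

end QDL

end

namespace QDL

/-! Factor each of Eve's measurement operators as `Bᴴ * B`; the rows `φ` of `B` refine it into
rank-one outcomes. Given the message `m`, such an outcome has weight `intensity (u m) φ / d`. As the
state is classical on A, data processing bounds the mutual information by the sum over these
outcomes of the entropy deficits of the weights, viewed as functions of `m`
(`mutualInfo_le_sum_deficit`). A deficit is small once all but a small fraction of the messages have
weight not much below the nominal value `‖φ‖² / d` (`deficit_le`). Individual weights need no upper
bound: the mean weights and the nominal values both sum to 1 over the outcomes.

It remains to find such a lower bound for all directions and all possible message sets at once. For
a unit vector `φ`, the amplitude `∑ φ ω * z ω` has second moment 1 and sub-Gaussian real and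
imaginary parts, whatever the law of the phases. By Chernoff, a set `B` of messages has mean
intensity at most `1 - η` with probability at most `exp (-|B| K η² / 512)`. Only sets with more than
`ηN` elements matter, where `N = M / 2 ^ n`; hence the exponent `N K η³`, and the `δ³` of the key
bound. A crude upper tail carries the estimate from a net to the whole sphere, through an operator
norm and Markov's inequality.

The union bound runs over a net of at most `(3 / δ²) ^ (2 d)` directions and over sets of at most
`N` messages, counted by `M ^ N`, which covers all leaks together. With `η = 20 δ`, the constants
let the Chernoff exponent beat this entropy whenever `K ≥ K_n`. The comparison of key sizes is
algebra. -/

/-! ### Entropy inequalities. -/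

/-- The log-sum inequality. -/
lemma sum_mul_logb_div_le {ι : Type*} (s : Finset ι) (t u : ι → ℝ) (ht : ∀ i, 0 ≤ t i)
    (hu : ∀ i, 0 ≤ u i) (h : ∀ i, u i = 0 → t i = 0) :
    (∑ i ∈ s, t i) * Real.logb 2 ((∑ i ∈ s, t i) / ∑ i ∈ s, u i) ≤
      ∑ i ∈ s, t i * Real.logb 2 (t i / u i) := by
  have hT : 0 ≤ ∑ i ∈ s, t i := Finset.sum_nonneg fun i _ => ht i
  have hU : 0 ≤ ∑ i ∈ s, u i := Finset.sum_nonneg fun i _ => hu i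
  have hlog2 : 0 < Real.log 2 := Real.log_pos one_lt_two
  rcases hT.eq_or_lt with hT0 | hTpos
  · have h0 := (Finset.sum_eq_zero_iff_of_nonneg fun i _ => ht i).1 hT0.symm
    rw [← hT0, zero_mul, Finset.sum_eq_zero]
    intro i hi
    rw [h0 i hi, zero_mul]
  have hUpos : 0 < ∑ i ∈ s, u i := by
    rcases hU.eq_or_lt with hU0 | hU0
    · exfalso
      have h0 := (Finset.sum_eq_zero_iff_of_nonneg fun i _ => hu i).1 hU0.symm
      exact hTpos.ne' (Finset.sum_eq_zero fun i hi => h i (h0 i hi))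
    · exact hU0
  set T := ∑ i ∈ s, t i with hTdef
  set U := ∑ i ∈ s, u i with hUdef
  have key : ∀ i ∈ s, t i * Real.log (T / U) + t i - u i * (T / U) ≤
      t i * Real.log (t i / u i) := by
    intro i _
    rcases (ht i).eq_or_lt with h0 | hpos
    · rw [← h0]
      simp only [zero_mul, zero_add, zero_sub, neg_nonpos]
      have := hu i
      positivity
    · have hui : 0 < u i := lt_of_le_of_ne (hu i) fun h0 => hpos.ne' (h i h0.symm)
      have h1 := Real.log_le_sub_one_of_pos (x := (T / U) / (t i / u i)) (by positivity)
      rw [Real.log_div (by positivity) (by positivity)] at h1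
      have h2 := mul_le_mul_of_nonneg_left h1 hpos.le
      have h3 : t i * ((T / U) / (t i / u i) - 1) = u i * (T / U) - t i := by
        field_simp
      rw [h3] at h2
      linarith
  have hsum := Finset.sum_le_sum key
  rw [Finset.sum_sub_distrib, Finset.sum_add_distrib, ← Finset.sum_mul, ← Finset.sum_mul, ← hTdef,
    ← hUdef, mul_div_cancel₀ _ hUpos.ne'] at hsum
  simp only [Real.logb, mul_div_assoc', ← Finset.sum_div]
  gcongr
  linarith

/-- Mutual information as a relative entropy. -/
lemma mutualInfo_eq_sum {X Y : Type*} [Fintype X] [Fintype Y] (p : X × Y → ℝ)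
    (hp : ∀ z, 0 ≤ p z) :
    mutualInfo p = ∑ x, ∑ y, p (x, y) *
      Real.logb 2 (p (x, y) / ((∑ y', p (x, y')) * ∑ x', p (x', y))) := by
  have e1 : entropy (fun x => ∑ y, p (x, y)) =
      ∑ x, ∑ y, -(p (x, y) * Real.logb 2 (∑ y', p (x, y'))) := by
    simp only [entropy, Finset.sum_mul, Finset.sum_neg_distrib]
  have e2 : entropy (fun y => ∑ x, p (x, y)) =
      ∑ x, ∑ y, -(p (x, y) * Real.logb 2 (∑ x', p (x', y))) := by
    rw [Finset.sum_comm]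
    simp only [entropy, Finset.sum_mul, Finset.sum_neg_distrib]
  have e3 : entropy p = ∑ x, ∑ y, -(p (x, y) * Real.logb 2 (p (x, y))) := by
    rw [entropy, Fintype.sum_prod_type]
  rw [mutualInfo, e1, e2, e3, ← Finset.sum_add_distrib, ← Finset.sum_sub_distrib]
  refine Finset.sum_congr rfl fun x _ => ?_
  rw [← Finset.sum_add_distrib, ← Finset.sum_sub_distrib]
  refine Finset.sum_congr rfl fun y _ => ?_
  rcases (hp (x, y)).eq_or_lt with h0 | hpos
  · simp [← h0]
  · have hx : 0 < ∑ y', p (x, y') := hpos.trans_le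
      (Finset.single_le_sum (f := fun y' => p (x, y')) (fun y' _ => hp _) (Finset.mem_univ y))
    have hy : 0 < ∑ x', p (x', y) := hpos.trans_le
      (Finset.single_le_sum (f := fun x' => p (x', y)) (fun x' _ => hp _) (Finset.mem_univ x))
    rw [Real.logb_div hpos.ne' (by positivity), Real.logb_mul hx.ne' hy.ne']
    ring

/-- The mean of `w`. -/
noncomputable def avg {σ : Type*} [Fintype σ] (w : σ → ℝ) : ℝ :=
  (∑ m, w m) / Fintype.card σ

/-- The entropy deficit of the weights `w`, in bits, scaled by their mean. -/
noncomputable def deficit {σ : Type*} [Fintype σ] (w : σ → ℝ) : ℝ :=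
  avg fun m => w m * Real.logb 2 (w m / avg w)

lemma avg_nonneg {σ : Type*} [Fintype σ] {w : σ → ℝ} (hw : ∀ m, 0 ≤ w m) : 0 ≤ avg w :=
  div_nonneg (Finset.sum_nonneg fun m _ => hw m) (Nat.cast_nonneg _)

lemma eq_zero_of_avg_eq_zero {σ : Type*} [Fintype σ] {w : σ → ℝ} (hw : ∀ m, 0 ≤ w m)
    (h : avg w = 0) (m : σ) : w m = 0 := by
  have : Nonempty σ := ⟨m⟩
  have hc : (Fintype.card σ : ℝ) ≠ 0 := by simp
  have h0 := (div_eq_zero_iff.1 h).resolve_right hc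
  exact (Finset.sum_eq_zero_iff_of_nonneg fun i _ => hw i).1 h0 m (Finset.mem_univ m)

lemma div_avg_le_card {σ : Type*} [Fintype σ] {w : σ → ℝ} (hw : ∀ m, 0 ≤ w m) (m : σ) :
    w m / avg w ≤ Fintype.card σ := by
  have : Nonempty σ := ⟨m⟩
  have hc : (0 : ℝ) < Fintype.card σ := by simp [Fintype.card_pos]
  rcases (avg_nonneg hw).eq_or_lt with h0 | hpos
  · rw [← h0, div_zero]; exact hc.le
  · rw [div_le_iff₀ hpos, avg, mul_div_cancel₀ _ hc.ne']
    exact Finset.single_le_sum (fun i _ => hw i) (Finset.mem_univ m)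

lemma logb_div_avg_le {σ : Type*} [Fintype σ] {w : σ → ℝ} (hw : ∀ m, 0 ≤ w m) (m : σ) :
    Real.logb 2 (w m / avg w) ≤ Real.logb 2 (Fintype.card σ) := by
  have : Nonempty σ := ⟨m⟩
  have hc : (1 : ℝ) ≤ Fintype.card σ := by exact_mod_cast Fintype.card_pos
  rcases (div_nonneg (hw m) (avg_nonneg hw)).eq_or_lt with h0 | hpos
  · rw [← h0, Real.logb_zero]
    exact Real.logb_nonneg one_lt_two hc
  · exact Real.logb_le_logb_of_le one_lt_two hpos (div_avg_le_card hw m)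

lemma deficit_le_avg_mul {σ : Type*} [Fintype σ] {w : σ → ℝ} (hw : ∀ m, 0 ≤ w m) :
    deficit w ≤ avg w * Real.logb 2 (Fintype.card σ) := by
  have h : ∑ m, w m * Real.logb 2 (w m / avg w) ≤
      (∑ m, w m) * Real.logb 2 (Fintype.card σ) := by
    rw [Finset.sum_mul]
    exact Finset.sum_le_sum fun m _ => mul_le_mul_of_nonneg_left (logb_div_avg_le hw m) (hw m)
  calc deficit w ≤ ((∑ m, w m) * Real.logb 2 (Fintype.card σ)) / Fintype.card σ :=
        div_le_div_of_nonneg_right h (Nat.cast_nonneg _)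
    _ = avg w * Real.logb 2 (Fintype.card σ) := by rw [avg, div_mul_eq_mul_div]

/-- If all but a fraction `θ` of the weights `w` are at least `(1 - θ) c`, then their entropy is
nearly maximal. -/
lemma deficit_le {σ : Type*} [Fintype σ] [Nonempty σ] {w : σ → ℝ} (hw : ∀ m, 0 ≤ w m) {c θ : ℝ}
    (hc : 0 ≤ c) (hθ : 0 ≤ θ) (hθ1 : θ < 1)
    (hbad : ((Finset.univ.filter fun m => w m < (1 - θ) * c).card : ℝ) ≤ θ * Fintype.card σ) :
    deficit w ≤ (avg w - (1 - θ) ^ 2 * c) * Real.logb 2 (Fintype.card σ) + 2 * θ * c := by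
  classical
  rcases hc.eq_or_lt with hc0 | hcpos
  · simpa [← hc0] using deficit_le_avg_mul hw
  have hN : (0 : ℝ) < Fintype.card σ := by simp [Fintype.card_pos]
  have hN1 : (1 : ℝ) ≤ Fintype.card σ := by exact_mod_cast Fintype.card_pos (α := σ)
  have hL : 0 ≤ Real.logb 2 (Fintype.card σ : ℝ) := Real.logb_nonneg one_lt_two hN1
  have hθ0 : 0 < 1 - θ := by linarith
  have hlog2 : 0 < Real.log 2 := Real.log_pos one_lt_two
  set N : ℝ := (Fintype.card σ : ℝ) with hNdef
  set L := Real.logb 2 N with hLdef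
  set G := Finset.univ.filter fun m => (1 - θ) * c ≤ w m with hG
  have hGcard : (1 - θ) * N ≤ G.card := by
    have h1 := Finset.card_filter_add_card_filter_not (s := (Finset.univ : Finset σ))
      (fun m => w m < (1 - θ) * c)
    simp only [not_lt, Finset.card_univ] at h1
    have h2 : ((Finset.univ.filter fun m => w m < (1 - θ) * c).card : ℝ) + G.card = N := by
      rw [hNdef]
      exact_mod_cast h1
    linarith
  have hwG : ∀ m ∈ G, 0 < w m := fun m hm =>
    lt_of_lt_of_le (by positivity) (Finset.mem_filter.1 hm).2
  have hGne : G.Nonempty := by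
    rw [← Finset.card_pos]
    have : (0 : ℝ) < G.card := lt_of_lt_of_le (by positivity) hGcard
    exact_mod_cast this
  have hsumw : ∑ m, w m = N * avg w := by rw [avg, mul_div_cancel₀ _ hN.ne']
  have hpos : 0 < avg w := by
    obtain ⟨m, hm⟩ := hGne
    have : 0 < ∑ m, w m := (hwG m hm).trans_le
      (Finset.single_le_sum (fun i _ => hw i) (Finset.mem_univ m))
    exact div_pos this hN
  -- On the good set `G`, split `w m` into `(1 - θ) c` and a nonnegative rest. The rest is charged
  -- the trivial bound `log |σ|`, while the main part uses `log t ≤ t - 1`, whose sum over `G` is at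
  -- most `N - |G| ≤ θ N`.
  have key : ∀ m, w m * Real.logb 2 (w m / avg w) ≤
      w m * L + if m ∈ G then (1 - θ) * c * ((w m / avg w - 1) / Real.log 2 - L) else 0 := by
    intro m
    have hle : Real.logb 2 (w m / avg w) ≤ L := logb_div_avg_le hw m
    split_ifs with hm
    · have hm' := (Finset.mem_filter.1 hm).2
      have hm0 := hwG m hm
      have h1 : Real.logb 2 (w m / avg w) ≤ (w m / avg w - 1) / Real.log 2 := by
        rw [Real.logb]
        gcongr
        exact Real.log_le_sub_one_of_pos (by positivity)
      have h2 := mul_le_mul_of_nonneg_left hle (sub_nonneg.2 hm')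
      have h3 := mul_le_mul_of_nonneg_left h1 (mul_pos hθ0 hcpos).le
      linarith
    · rw [add_zero]
      exact mul_le_mul_of_nonneg_left hle (hw m)
  have hG2 : ∑ m ∈ G, w m / avg w ≤ N := by
    rw [← Finset.sum_div, div_le_iff₀ hpos, ← hsumw]
    exact Finset.sum_le_sum_of_subset_of_nonneg (Finset.subset_univ G) fun i _ _ => hw i
  have hG1 : ∑ m ∈ G, ((w m / avg w - 1) / Real.log 2 - L) ≤
      θ * N / Real.log 2 - (1 - θ) * N * L := by
    rw [Finset.sum_sub_distrib, ← Finset.sum_div, Finset.sum_sub_distrib]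
    simp only [Finset.sum_const, nsmul_eq_mul, mul_one]
    have : (∑ m ∈ G, w m / avg w - G.card) / Real.log 2 ≤ θ * N / Real.log 2 := by
      gcongr
      linarith
    have := mul_le_mul_of_nonneg_right hGcard hL
    linarith
  have hsum : ∑ m, w m * Real.logb 2 (w m / avg w) ≤
      N * avg w * L + (1 - θ) * c * (θ * N / Real.log 2 - (1 - θ) * N * L) := by
    refine (Finset.sum_le_sum fun m _ => key m).trans ?_
    rw [Finset.sum_add_distrib, ← Finset.sum_mul, hsumw, Finset.sum_ite_mem, Finset.univ_inter,
      ← Finset.mul_sum]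
    gcongr
  have hdef : deficit w ≤ (N * avg w * L +
      (1 - θ) * c * (θ * N / Real.log 2 - (1 - θ) * N * L)) / N :=
    div_le_div_of_nonneg_right hsum hN.le
  have heq : (N * avg w * L + (1 - θ) * c * (θ * N / Real.log 2 - (1 - θ) * N * L)) / N =
      (avg w - (1 - θ) ^ 2 * c) * L + (1 - θ) * c * θ / Real.log 2 := by
    field_simp
    ring
  have hlast : (1 - θ) * c * θ / Real.log 2 ≤ 2 * θ * c := by
    rw [div_le_iff₀ hlog2]
    have hl2 : 1 / 2 ≤ Real.log 2 := by have := Real.log_two_gt_d9; linarith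
    have h1 : 0 ≤ θ * c := mul_nonneg hθ hc
    nlinarith [mul_nonneg h1 hθ, mul_nonneg h1 (sub_nonneg.2 hl2)]
  linarith

/-- Data processing for the mixture `p` of the product distributions `a · m × ∑ j, w · j m`. -/
lemma mutualInfo_le_sum_deficit {σ X Y J : Type*} [Fintype σ] [Nonempty σ] [Fintype X] [Fintype Y]
    [Fintype J] (a : X → σ → ℝ) (w : Y → J → σ → ℝ) (ha : ∀ x m, 0 ≤ a x m)
    (hw : ∀ y j m, 0 ≤ w y j m) (ha1 : ∀ m, ∑ x, a x m = 1) (hw1 : ∀ m, ∑ y, ∑ j, w y j m = 1) :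
    mutualInfo (fun z : X × Y => avg fun m => a z.1 m * ∑ j, w z.2 j m) ≤
      ∑ y, ∑ j, deficit (w y j) := by
  have hN : (0 : ℝ) < Fintype.card σ := by simp [Fintype.card_pos]
  set p : X × Y → ℝ := fun z => avg fun m => a z.1 m * ∑ j, w z.2 j m with hpdef
  have hp : ∀ z, 0 ≤ p z := fun z =>
    avg_nonneg fun m => mul_nonneg (ha _ _) (Finset.sum_nonneg fun j _ => hw _ _ _)
  have hpX : ∀ x, ∑ y, p (x, y) = (∑ m, a x m) / Fintype.card σ := by
    intro x
    simp only [hpdef, avg]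
    rw [← Finset.sum_div, Finset.sum_comm]
    simp only [← Finset.mul_sum, hw1, mul_one]
  have hpY : ∀ y, ∑ x, p (x, y) = ∑ j, avg (w y j) := by
    intro y
    simp only [hpdef, avg]
    rw [← Finset.sum_div, ← Finset.sum_div, Finset.sum_comm]
    simp only [← Finset.sum_mul, ha1, one_mul]
    rw [Finset.sum_comm]
  have key : ∀ x y, p (x, y) *
      Real.logb 2 (p (x, y) / ((∑ y', p (x, y')) * ∑ x', p (x', y))) ≤
      ∑ m, ∑ j, a x m * (w y j m * Real.logb 2 (w y j m / avg (w y j))) / Fintype.card σ := by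
    intro x y
    -- The outcome `(x, y)` coarse-grains the tuples `(x, y, m, j)`. The reference weights replace
    -- `w y j m` by its mean over `m`, so their sum over `(m, j)` is the product of the marginals at
    -- `(x, y)`.
    have h := sum_mul_logb_div_le (Finset.univ : Finset (σ × J))
      (fun i => a x i.1 * w y i.2 i.1 / Fintype.card σ)
      (fun i => a x i.1 * avg (w y i.2) / Fintype.card σ)
      (fun i => div_nonneg (mul_nonneg (ha _ _) (hw _ _ _)) hN.le)
      (fun i => div_nonneg (mul_nonneg (ha _ _) (avg_nonneg (hw _ _))) hN.le)
      (fun i hi => by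
        rcases mul_eq_zero.1 ((div_eq_zero_iff.1 hi).resolve_right hN.ne') with h | h
        · simp [h]
        · simp [eq_zero_of_avg_eq_zero (hw _ _) h])
    have e1 : ∑ i : σ × J, a x i.1 * w y i.2 i.1 / Fintype.card σ = p (x, y) := by
      rw [Fintype.sum_prod_type]
      simp only [hpdef, avg, Finset.mul_sum, Finset.sum_div]
    have e2 : ∑ i : σ × J, a x i.1 * avg (w y i.2) / Fintype.card σ =
        (∑ y', p (x, y')) * ∑ x', p (x', y) := by
      rw [Fintype.sum_prod_type, hpX, hpY, Finset.sum_div, Finset.sum_mul_sum]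
      refine Finset.sum_congr rfl fun m _ => Finset.sum_congr rfl fun j _ => ?_
      ring
    rw [e1, e2, Fintype.sum_prod_type] at h
    refine h.trans (le_of_eq ?_)
    refine Finset.sum_congr rfl fun m _ => Finset.sum_congr rfl fun j _ => ?_
    rcases (ha x m).eq_or_lt with h0 | h0
    · simp [← h0]
    · have : a x m * w y j m / Fintype.card σ / (a x m * avg (w y j) / Fintype.card σ) =
          w y j m / avg (w y j) := by
        rw [div_div_div_cancel_right₀ hN.ne', mul_div_mul_left _ _ h0.ne']
      simp only [this]
      ring
  rw [mutualInfo_eq_sum p hp]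
  refine (Finset.sum_le_sum fun x _ => Finset.sum_le_sum fun y _ => key x y).trans (le_of_eq ?_)
  rw [Finset.sum_comm]
  refine Finset.sum_congr rfl fun y _ => ?_
  have e : ∀ m j, ∑ x, a x m * (w y j m * Real.logb 2 (w y j m / avg (w y j))) / Fintype.card σ =
      w y j m * Real.logb 2 (w y j m / avg (w y j)) / Fintype.card σ := by
    intro m j
    rw [← Finset.sum_div, ← Finset.sum_mul, ha1, one_mul]
  rw [Finset.sum_comm]
  simp_rw [Finset.sum_comm (s := (Finset.univ : Finset X)), e]
  rw [Finset.sum_comm]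
  simp only [← Finset.sum_div, deficit]
  exact Finset.sum_div _ _ _

/-! ### From accessible information to intensities. -/

/-- The mean over the key of `|⟨φ̄, u k⟩|²`. -/
noncomputable def intensity {K d : ℕ} (u : Fin K → Fin d → ℂ) (φ : EuclideanSpace ℂ (Fin d)) : ℝ :=
  (∑ k, ‖∑ ω, φ ω * u k ω‖ ^ 2) / K

lemma intensity_nonneg {K d : ℕ} (u : Fin K → Fin d → ℂ) (φ : EuclideanSpace ℂ (Fin d)) :
    0 ≤ intensity u φ := by
  unfold intensity
  positivity

-- The square root of `Q` serves as `B`; the rows of `B` will be the vectors of Eve's refined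
-- measurement.
open scoped MatrixOrder in
lemma PosSemidef.exists_eq_conjTranspose_mul_self {ι : Type*} [Fintype ι] [DecidableEq ι]
    {Q : Matrix ι ι ℂ} (hQ : Q.PosSemidef) : ∃ B : Matrix ι ι ℂ, Q = Bᴴ * B := by
  obtain ⟨X, hX, -, h⟩ := CFC.exists_sqrt_of_isSelfAdjoint_of_quasispectrumRestricts
    hQ.isHermitian (QuasispectrumRestricts.nnreal_of_nonneg hQ.nonneg)
  exact ⟨X, by rw [← h, ← Matrix.star_eq_conjTranspose, hX.star_eq]⟩

lemma trace_conjTranspose_mul_self_mul_vecMulVec {ι : Type*} [Fintype ι] (B : Matrix ι ι ℂ)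
    (v : ι → ℂ) : (Bᴴ * B * Matrix.vecMulVec v (star v)).trace =
      ((∑ j, ‖(B *ᵥ v) j‖ ^ 2 : ℝ) : ℂ) := by
  rw [Matrix.mul_vecMulVec, Matrix.trace_vecMulVec, dotProduct_comm, ← Matrix.mulVec_mulVec,
    Matrix.dotProduct_mulVec, ← Matrix.star_mulVec, dotProduct]
  push_cast
  refine Finset.sum_congr rfl fun j _ => ?_
  rw [Pi.star_apply, ← Complex.conj_mul', starRingEnd_apply]

lemma trace_conjTranspose_mul_self {ι : Type*} [Fintype ι] (B : Matrix ι ι ℂ) :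
    (Bᴴ * B).trace = ((∑ j, ∑ i, ‖B j i‖ ^ 2 : ℝ) : ℂ) := by
  rw [Matrix.trace_mul_comm, Matrix.trace]
  push_cast
  refine Finset.sum_congr rfl fun j _ => ?_
  rw [Matrix.diag_apply, Matrix.mul_apply]
  refine Finset.sum_congr rfl fun i _ => ?_
  rw [Matrix.conjTranspose_apply, ← Complex.mul_conj', starRingEnd_apply]

lemma mulVec_phaseVector {d : ℕ} (B : Matrix (Fin d) (Fin d) ℂ) (u : Fin d → ℂ) (j : Fin d) :
    ‖(B *ᵥ phaseVector u) j‖ ^ 2 = ‖∑ ω, B j ω * u ω‖ ^ 2 / d := by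
  have : (B *ᵥ phaseVector u) j = (1 / (Real.sqrt d : ℂ)) * ∑ ω, B j ω * u ω := by
    simp only [Matrix.mulVec, dotProduct, phaseVector, Finset.mul_sum]
    refine Finset.sum_congr rfl fun i _ => ?_
    ring
  rw [this, norm_mul, mul_pow, norm_div, Complex.norm_real, norm_one, div_pow, one_pow,
    Real.norm_eq_abs, sq_abs, Real.sq_sqrt (Nat.cast_nonneg d)]
  ring

/-- The state is block diagonal in the message, so a measurement on A only enters through its
diagonal entries, a classical channel `m ↦ x`. This exhibits the outcome distribution as a mixture
of products, as `mutualInfo_le_sum_deficit` requires. -/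
lemma outcomeDist_cqState {M K d : ℕ} {X Y : Type*} [Fintype X] [Fintype Y]
    (u : Fin M → Fin K → Fin d → ℂ) (S : Finset (Fin M)) (P : POVM {m // m ∈ S} X)
    (Q : POVM (Fin d) Y) (B : Y → Matrix (Fin d) (Fin d) ℂ) (hB : ∀ y, Q.elem y = (B y)ᴴ * B y) :
    outcomeDist (cqState (fun m k => phaseVector (u m k)) S) P Q =
      fun z => avg fun m : {m // m ∈ S} => (P.elem z.1 m m).re *
        ∑ j, intensity (u m) (WithLp.toLp 2 (B z.2 j)) / d := by
  funext z
  have e : ∀ m : {m // m ∈ S}, (((P.elem z.1) ⊗ₖ (Q.elem z.2)) *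
      (Matrix.single m m (1 : ℂ) ⊗ₖ ((1 / (K : ℂ)) • ∑ k : Fin K,
        Matrix.vecMulVec (phaseVector (u m k)) (star (phaseVector (u m k)))))).trace =
      P.elem z.1 m m * ((∑ j, intensity (u m) (WithLp.toLp 2 (B z.2 j)) / d : ℝ) : ℂ) := by
    intro m
    rw [← Matrix.mul_kronecker_mul, Matrix.trace_kronecker, Matrix.trace_mul_single]
    rw [hB, Matrix.mul_smul, Matrix.trace_smul, Matrix.mul_sum, Matrix.trace_sum]
    simp only [trace_conjTranspose_mul_self_mul_vecMulVec, mulVec_phaseVector, intensity]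
    congr 1
    · simp
    rw [← Complex.ofReal_sum, Finset.sum_comm]
    push_cast
    simp only [smul_eq_mul, Finset.mul_sum, Finset.sum_div]
    refine Finset.sum_congr rfl fun j _ => Finset.sum_congr rfl fun k _ => ?_
    ring
  simp only [outcomeDist, cqState, Matrix.mul_smul, Matrix.trace_smul, Matrix.mul_sum,
    Matrix.trace_sum, e, avg]
  rw [smul_eq_mul, ← Complex.ofReal_natCast, ← Complex.ofReal_one, ← Complex.ofReal_div,
    Complex.re_ofReal_mul, Complex.re_sum]
  simp only [Complex.re_mul_ofReal, Fintype.card_coe]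
  ring

/-- The mutual information of the outcomes of local measurements is bounded by the one obtained by
a rank-one measurement `φ` of Eve. -/
lemma exists_mutualInfo_outcomeDist_le {M K d : ℕ} (hK : 0 < K) (hd : 0 < d) {X Y : Type*}
    [Fintype X] [Fintype Y] (u : Fin M → Fin K → Fin d → ℂ) (hu : ∀ m k ω, ‖u m k ω‖ = 1)
    (S : Finset (Fin M)) (hS : S.Nonempty) (P : POVM {m // m ∈ S} X) (Q : POVM (Fin d) Y) :
    ∃ φ : Y → Fin d → EuclideanSpace ℂ (Fin d), (∑ y, ∑ j, ‖φ y j‖ ^ 2 / d = 1) ∧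
      (∑ y, ∑ j, avg (fun m : {m // m ∈ S} => intensity (u m) (φ y j) / d) = 1) ∧
      mutualInfo (outcomeDist (cqState (fun m k => phaseVector (u m k)) S) P Q) ≤
        ∑ y, ∑ j, deficit (fun m : {m // m ∈ S} => intensity (u m) (φ y j) / d) := by
  have : Nonempty {m // m ∈ S} := hS.to_subtype
  have hN : (Fintype.card {m // m ∈ S} : ℝ) ≠ 0 := by
    simpa using hS.ne_empty
  have hd0 : (d : ℝ) ≠ 0 := by positivity
  have hK0 : (K : ℝ) ≠ 0 := by positivity
  choose B hB using fun y => PosSemidef.exists_eq_conjTranspose_mul_self (Q.posSemidef y)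
  -- Normalization for each message: the codewords are unit vectors and the operators `Bᴴ * B` sum
  -- to 1.
  have hw1 : ∀ m, ∑ y, ∑ j, intensity (u m) (WithLp.toLp 2 (B y j)) / d = 1 := by
    intro m
    have h1 : ∀ k, ∑ y, ∑ j, ‖∑ ω, B y j ω * u m k ω‖ ^ 2 / d = 1 := by
      intro k
      have h2 : ∑ y, (Q.elem y * Matrix.vecMulVec (phaseVector (u m k))
          (star (phaseVector (u m k)))).trace = 1 := by
        rw [← Matrix.trace_sum, ← Matrix.sum_mul, Q.sum_elem, one_mul]
        have h3 := trace_conjTranspose_mul_self_mul_vecMulVec (1 : Matrix (Fin d) (Fin d) ℂ)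
          (phaseVector (u m k))
        rw [Matrix.conjTranspose_one, one_mul, one_mul] at h3
        rw [h3]
        simp only [mulVec_phaseVector]
        simp [Matrix.one_apply, hu, hd0]
      simp only [hB, trace_conjTranspose_mul_self_mul_vecMulVec, mulVec_phaseVector] at h2
      exact_mod_cast h2
    calc ∑ y, ∑ j, intensity (u m) (WithLp.toLp 2 (B y j)) / d
        = (∑ k, ∑ y, ∑ j, ‖∑ ω, B y j ω * u m k ω‖ ^ 2 / d) / K := by
          rw [Finset.sum_comm (s := (Finset.univ : Finset (Fin K))), Finset.sum_div]
          refine Finset.sum_congr rfl fun y _ => ?_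
          rw [Finset.sum_comm (s := (Finset.univ : Finset (Fin K))), Finset.sum_div]
          refine Finset.sum_congr rfl fun j _ => ?_
          rw [intensity, ← Finset.sum_div]
          ring
      _ = 1 := by simp [h1, hK0]
  refine ⟨fun y j => WithLp.toLp 2 (B y j), ?_, ?_, ?_⟩
  -- The total squared norm of the rows is the trace of the identity.
  · have h1 : ∑ y, (Q.elem y).trace = d := by
      rw [← Matrix.trace_sum, Q.sum_elem, Matrix.trace_one, Fintype.card_fin]
    simp only [hB, trace_conjTranspose_mul_self] at h1
    have h2 : ∑ y, ∑ j, ∑ i, ‖B y j i‖ ^ 2 = (d : ℝ) := by exact_mod_cast h1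
    simp only [EuclideanSpace.norm_sq_eq, ← Finset.sum_div]
    rw [h2, div_self hd0]
  · have h1 : ∑ m : {m // m ∈ S}, ∑ y, ∑ j, intensity (u m) (WithLp.toLp 2 (B y j)) / d =
        Fintype.card {m // m ∈ S} := by
      simp [hw1]
    refine Eq.trans ?_ ((congrArg (· / (Fintype.card {m // m ∈ S} : ℝ)) h1).trans (div_self hN))
    simp only [avg]
    rw [Finset.sum_comm (s := (Finset.univ : Finset {m // m ∈ S})), Finset.sum_div]
    refine Finset.sum_congr rfl fun y _ => ?_
    rw [Finset.sum_comm (s := (Finset.univ : Finset {m // m ∈ S})), Finset.sum_div]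
  · rw [outcomeDist_cqState u S P Q B hB]
    have hP : ∀ x m, 0 ≤ (P.elem x m m).re := fun x m =>
      (Complex.le_def.1 ((P.posSemidef x).diag_nonneg (i := m))).1
    refine mutualInfo_le_sum_deficit (fun x m => (P.elem x m m).re)
      (fun y j (m : {m // m ∈ S}) => intensity (u m) (WithLp.toLp 2 (B y j)) / d) hP
      (fun y j m => div_nonneg (intensity_nonneg _ _) (Nat.cast_nonneg d)) (fun m => ?_)
      (fun m => hw1 m)
    have h1 : (∑ x, P.elem x) m m = 1 := by rw [P.sum_elem, Matrix.one_apply_eq]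
    rw [Matrix.sum_apply] at h1
    rw [← Complex.re_sum, h1, Complex.one_re]

/-- Each deficit is at most the mean weight times `log |S|`, and the mean weights sum to 1. This
settles the degenerate parameters, where concentration is neither available nor needed. -/
lemma accInfo_cqState_le_logb_card {M K d : ℕ} (hK : 0 < K) (hd : 0 < d)
    (u : Fin M → Fin K → Fin d → ℂ) (hu : ∀ m k ω, ‖u m k ω‖ = 1) (S : Finset (Fin M))
    (hS : S.Nonempty) : accInfo (cqState (fun m k => phaseVector (u m k)) S) ≤
      ((Real.logb 2 S.card : ℝ) : EReal) := by
  refine iSup_le fun a => iSup_le fun b => iSup_le fun P => iSup_le fun Q => ?_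
  obtain ⟨φ, -, h2, h3⟩ := exists_mutualInfo_outcomeDist_le hK hd u hu S hS P Q
  refine EReal.coe_le_coe_iff.2 (h3.trans ?_)
  have h4 : ∀ y j, deficit (fun m : {m // m ∈ S} => intensity (u m) (φ y j) / d) ≤
      avg (fun m : {m // m ∈ S} => intensity (u m) (φ y j) / d) * Real.logb 2 S.card := by
    intro y j
    have := deficit_le_avg_mul (w := fun m : {m // m ∈ S} => intensity (u m) (φ y j) / d)
      fun m => div_nonneg (intensity_nonneg _ _) (Nat.cast_nonneg d)
    rwa [Fintype.card_coe] at this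
  refine (Finset.sum_le_sum fun y _ => Finset.sum_le_sum fun j _ => h4 y j).trans (le_of_eq ?_)
  simp only [← Finset.sum_mul, h2, one_mul]

/-- If, in every direction, all but a fraction `θ` of the messages have nearly the expected
intensity, then the accessible information is small. -/
lemma accInfo_cqState_le {M K d : ℕ} (hK : 0 < K) (hd : 0 < d)
    (u : Fin M → Fin K → Fin d → ℂ) (hu : ∀ m k ω, ‖u m k ω‖ = 1) (S : Finset (Fin M))
    (hS : 2 ≤ S.card) {θ : ℝ} (hθ : 0 ≤ θ) (hθ1 : θ < 1)
    (h : ∀ φ : EuclideanSpace ℂ (Fin d),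
      ((S.filter fun m => intensity (u m) φ < (1 - θ) * ‖φ‖ ^ 2).card : ℝ) ≤ θ * S.card) :
    accInfo (cqState (fun m k => phaseVector (u m k)) S) ≤
      ((4 * θ * Real.logb 2 S.card : ℝ) : EReal) := by
  have hS' : S.Nonempty := Finset.card_pos.1 (by omega)
  have : Nonempty {m // m ∈ S} := hS'.to_subtype
  have hd0 : (0 : ℝ) < d := by positivity
  refine iSup_le fun a => iSup_le fun b => iSup_le fun P => iSup_le fun Q => ?_
  obtain ⟨φ, h1, h2, h3⟩ := exists_mutualInfo_outcomeDist_le hK hd u hu S hS' P Q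
  refine EReal.coe_le_coe_iff.2 (h3.trans ?_)
  have h4 : ∀ y j, deficit (fun m : {m // m ∈ S} => intensity (u m) (φ y j) / d) ≤
      (avg (fun m : {m // m ∈ S} => intensity (u m) (φ y j) / d) -
        (1 - θ) ^ 2 * (‖φ y j‖ ^ 2 / d)) * Real.logb 2 S.card + 2 * θ * (‖φ y j‖ ^ 2 / d) := by
    intro y j
    have := deficit_le (w := fun m : {m // m ∈ S} => intensity (u m) (φ y j) / d)
      (fun m => div_nonneg (intensity_nonneg _ _) (Nat.cast_nonneg d))
      (c := ‖φ y j‖ ^ 2 / d) (by positivity) hθ hθ1 (by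
        rw [Fintype.card_coe]
        refine le_trans (le_of_eq ?_) (h (φ y j))
        congr 1
        rw [← Finset.card_map (Function.Embedding.subtype fun m => m ∈ S)]
        congr 1
        ext m
        simp only [Finset.mem_map, Finset.mem_filter, Finset.mem_univ, true_and,
          Function.Embedding.subtype_apply, Subtype.exists, exists_and_left, exists_prop,
          mul_div_assoc', div_lt_div_iff_of_pos_right hd0]
        constructor
        · rintro ⟨m', h1, h2, rfl⟩; exact ⟨h2, h1⟩
        · rintro ⟨h1, h2⟩; exact ⟨m, h2, h1, rfl⟩)
    rwa [Fintype.card_coe] at this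
  refine (Finset.sum_le_sum fun y _ => Finset.sum_le_sum fun j _ => h4 y j).trans ?_
  simp only [Finset.sum_add_distrib, ← Finset.sum_mul, Finset.sum_sub_distrib, ← Finset.mul_sum,
    h1, h2]
  -- The sum is `(1 - (1 - θ)²) log |S| + 2θ`; since `|S| ≥ 2`, the additive `2θ` is absorbed into
  -- `2θ log |S|`.
  have hL : 1 ≤ Real.logb 2 S.card := by
    rw [Real.le_logb_iff_rpow_le one_lt_two (by positivity), Real.rpow_one]
    exact_mod_cast hS
  nlinarith [mul_nonneg hθ hθ, mul_nonneg hθ (sub_nonneg.2 hL)]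

/-! ### Exponential moments of the squared amplitude. -/

lemma norm_sum_mul_le {Ω ι : Type*} [Fintype ι] {z : ι → Ω → ℂ} (a : ι → ℂ)
    (hz : ∀ i x, ‖z i x‖ = 1) (x : Ω) : ‖∑ i, a i * z i x‖ ≤ ∑ i, ‖a i‖ :=
  (norm_sum_le _ _).trans (le_of_eq (by simp [hz]))

section Moments

variable {Ω : Type*} [MeasurableSpace Ω] {μ : Measure Ω} [IsProbabilityMeasure μ]

lemma lintegral_exp_neg_mul_sq {b : ℝ} (hb : 0 < b) :
    ∫⁻ g : ℝ, ENNReal.ofReal (Real.exp (-b * g ^ 2)) = ENNReal.ofReal (√(Real.pi / b)) := by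
  rw [← ofReal_integral_eq_lintegral_ofReal (integrable_exp_neg_mul_sq hb)
    (Filter.Eventually.of_forall fun _ => (Real.exp_pos _).le), integral_gaussian]

/-- The exponential moment of the square of a sub-Gaussian variable, by Gaussian linearization. -/
lemma lintegral_exp_sq_div_four_le {Y : Ω → ℝ} (hY : Measurable Y)
    (h : HasSubgaussianMGF Y 1 μ) :
    ∫⁻ x, ENNReal.ofReal (Real.exp (Y x ^ 2 / 4)) ∂μ ≤ ENNReal.ofReal √2 := by
  -- Completing the square writes `√π exp (y² / 4)` as a Gaussian integral of `exp (g y)`. After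
  -- Tonelli, the sub-Gaussian bound leaves `∫ exp (-g² / 2) = √π √2`.
  have h1 : ∀ y : ℝ, ∫⁻ g : ℝ, ENNReal.ofReal (Real.exp (g * y)) *
      ENNReal.ofReal (Real.exp (-1 * g ^ 2)) =
      ENNReal.ofReal √Real.pi * ENNReal.ofReal (Real.exp (y ^ 2 / 4)) := by
    intro y
    have e : ∀ g : ℝ, ENNReal.ofReal (Real.exp (g * y)) *
        ENNReal.ofReal (Real.exp (-1 * g ^ 2)) =
        ENNReal.ofReal (Real.exp (-1 * (g - y / 2) ^ 2)) *
          ENNReal.ofReal (Real.exp (y ^ 2 / 4)) := by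
      intro g
      rw [← ENNReal.ofReal_mul (Real.exp_pos _).le, ← ENNReal.ofReal_mul (Real.exp_pos _).le,
        ← Real.exp_add, ← Real.exp_add]
      congr 2
      ring
    simp only [e]
    rw [lintegral_mul_const _ (by fun_prop), lintegral_sub_right_eq_self
      (fun g : ℝ => ENNReal.ofReal (Real.exp (-1 * g ^ 2))) (y / 2),
      lintegral_exp_neg_mul_sq one_pos, div_one]
  have h2 : ∀ g : ℝ, ∫⁻ x, ENNReal.ofReal (Real.exp (g * Y x)) ∂μ ≤
      ENNReal.ofReal (Real.exp (g ^ 2 / 2)) := by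
    intro g
    rw [← ofReal_integral_eq_lintegral_ofReal (h.integrable_exp_mul g)
      (Filter.Eventually.of_forall fun _ => (Real.exp_pos _).le)]
    refine ENNReal.ofReal_le_ofReal ?_
    simpa [mgf] using h.mgf_le g
  have h3 : ENNReal.ofReal √Real.pi * ∫⁻ x, ENNReal.ofReal (Real.exp (Y x ^ 2 / 4)) ∂μ ≤
      ENNReal.ofReal √Real.pi * ENNReal.ofReal √2 := by
    calc ENNReal.ofReal √Real.pi * ∫⁻ x, ENNReal.ofReal (Real.exp (Y x ^ 2 / 4)) ∂μ
        = ∫⁻ x, (∫⁻ g : ℝ, ENNReal.ofReal (Real.exp (g * Y x)) *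
            ENNReal.ofReal (Real.exp (-1 * g ^ 2))) ∂μ := by
          simp only [h1]
          rw [lintegral_const_mul _ (by fun_prop)]
      _ = ∫⁻ g : ℝ, ∫⁻ x, ENNReal.ofReal (Real.exp (g * Y x)) *
            ENNReal.ofReal (Real.exp (-1 * g ^ 2)) ∂μ := by
          rw [lintegral_lintegral_swap]
          exact Measurable.aemeasurable (by fun_prop)
      _ ≤ ∫⁻ g : ℝ, ENNReal.ofReal (Real.exp (-(1 / 2) * g ^ 2)) := by
          refine lintegral_mono fun g => ?_
          rw [lintegral_mul_const _ (by fun_prop)]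
          refine (mul_le_mul_left (h2 g) _).trans (le_of_eq ?_)
          rw [← ENNReal.ofReal_mul (Real.exp_pos _).le, ← Real.exp_add]
          congr 2
          ring
      _ = ENNReal.ofReal √Real.pi * ENNReal.ofReal √2 := by
          rw [lintegral_exp_neg_mul_sq (by norm_num), ← ENNReal.ofReal_mul (Real.sqrt_nonneg _),
            ← Real.sqrt_mul Real.pi_pos.le]
          congr 2
          ring
  exact (ENNReal.mul_le_mul_iff_right (by simp [Real.pi_pos]) ENNReal.ofReal_ne_top).1 h3

variable {ι : Type*} [Fintype ι]

/-- Hoeffding's lemma gives a variable in `[-r, r]` the variance proxy `r²`, and proxies of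
independent variables add. -/
lemma hasSubgaussianMGF_sum {X : ι → Ω → ℝ} {r : ι → ℝ} (hX : ∀ i, Measurable (X i))
    (hind : iIndepFun X μ) (hb : ∀ i x, |X i x| ≤ r i) (h0 : ∀ i, ∫ x, X i x ∂μ = 0)
    (hr : ∑ i, r i ^ 2 = 1) : HasSubgaussianMGF (fun x => ∑ i, X i x) 1 μ := by
  have h := HasSubgaussianMGF.sum_of_iIndepFun hind (s := Finset.univ) (fun i _ =>
    hasSubgaussianMGF_of_mem_Icc_of_integral_eq_zero (hX i).aemeasurable
      (Filter.Eventually.of_forall fun x => abs_le.1 (hb i x)) (h0 i))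
  convert h
  have e : ∀ i, ((‖r i - -r i‖₊ / 2) ^ 2 : NNReal) = Real.toNNReal (r i ^ 2) := by
    intro i
    ext
    rw [Real.coe_toNNReal _ (sq_nonneg _)]
    push_cast
    rw [Real.norm_eq_abs, sub_neg_eq_add, ← two_mul, abs_mul, abs_two,
      mul_div_cancel_left₀ _ two_ne_zero, sq_abs]
  ext
  simp only [e]
  rw [NNReal.coe_one, NNReal.coe_sum, ← hr]
  simp only [Real.coe_toNNReal _ (sq_nonneg _)]

lemma integral_sum_sq {X : ι → Ω → ℝ} {r : ι → ℝ} (hX : ∀ i, Measurable (X i))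
    (hind : iIndepFun X μ) (hb : ∀ i x, |X i x| ≤ r i) (h0 : ∀ i, ∫ x, X i x ∂μ = 0) :
    ∫ x, (∑ i, X i x) ^ 2 ∂μ = ∑ i, ∫ x, X i x ^ 2 ∂μ := by
  have hL : ∀ i, MemLp (X i) 2 μ := fun i =>
    MemLp.of_bound (hX i).aestronglyMeasurable (r i) (Filter.Eventually.of_forall fun x => hb i x)
  have hint : ∀ i, Integrable (X i) μ := fun i => (hL i).integrable one_le_two
  have h := IndepFun.variance_sum (s := Finset.univ) (fun i _ => hL i)
    (fun i _ j _ hij => hind.indepFun hij)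
  rw [variance_of_integral_eq_zero] at h
  · simp only [variance_of_integral_eq_zero (hX _).aemeasurable (h0 _), Finset.sum_apply] at h
    exact h
  · exact Finset.aemeasurable_sum _ fun i _ => (hX i).aemeasurable
  · simp only [Finset.sum_apply]
    rw [integral_finsetSum _ fun i _ => hint i]
    simp [h0]

variable {z : ι → Ω → ℂ} {a : ι → ℂ}

lemma integrable_comp_of_continuous (hz : ∀ i x, ‖z i x‖ = 1) (hm : ∀ i, Measurable (z i))
    {f : ℝ → ℝ} (hf : Continuous f) : Integrable (fun x => f (‖∑ i, a i * z i x‖ ^ 2)) μ := by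
  obtain ⟨C, hC⟩ := (isCompact_Icc (a := (0 : ℝ))
    (b := (∑ i, ‖a i‖) ^ 2)).exists_bound_of_continuousOn hf.continuousOn
  refine Integrable.of_bound (C := C) ?_
    (Filter.Eventually.of_forall fun x => hC _ ⟨by positivity, ?_⟩)
  · exact (hf.measurable.comp (by fun_prop)).aestronglyMeasurable
  · gcongr
    exact norm_sum_mul_le a hz x

/-- Real and imaginary parts of `∑ i, a i * z i`, for independent mean-zero phases `z i`. -/
lemma exists_sum_re_im (hz : ∀ i x, ‖z i x‖ = 1) (hm : ∀ i, Measurable (z i))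
    (hind : iIndepFun z μ) (h0 : ∀ i, ∫ x, z i x ∂μ = 0) :
    ∃ X Y : ι → Ω → ℝ, (∀ i, Measurable (X i)) ∧ (∀ i, Measurable (Y i)) ∧ iIndepFun X μ ∧
      iIndepFun Y μ ∧ (∀ i x, |X i x| ≤ ‖a i‖) ∧ (∀ i x, |Y i x| ≤ ‖a i‖) ∧
      (∀ i, ∫ x, X i x ∂μ = 0) ∧ (∀ i, ∫ x, Y i x ∂μ = 0) ∧
      (∀ i x, X i x ^ 2 + Y i x ^ 2 = ‖a i‖ ^ 2) ∧
      ∀ x, ‖∑ i, a i * z i x‖ ^ 2 = (∑ i, X i x) ^ 2 + (∑ i, Y i x) ^ 2 := by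
  have hint : ∀ i, Integrable (fun x => a i * z i x) μ := fun i =>
    (Integrable.of_bound (C := 1) (hm i).aestronglyMeasurable
      (Filter.Eventually.of_forall fun x => (hz i x).le)).const_mul _
  have hzero : ∀ i, ∫ x, a i * z i x ∂μ = 0 := fun i => by
    rw [integral_const_mul, h0, mul_zero]
  have hn : ∀ i x, ‖a i * z i x‖ = ‖a i‖ := fun i x => by rw [norm_mul, hz, mul_one]
  refine ⟨fun i x => (a i * z i x).re, fun i x => (a i * z i x).im,
    fun i => Complex.measurable_re.comp ((hm i).const_mul _),
    fun i => Complex.measurable_im.comp ((hm i).const_mul _),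
    hind.comp (fun i w => (a i * w).re) fun i =>
      Complex.measurable_re.comp (measurable_id.const_mul _),
    hind.comp (fun i w => (a i * w).im) fun i =>
      Complex.measurable_im.comp (measurable_id.const_mul _),
    fun i x => (Complex.abs_re_le_norm _).trans (hn i x).le,
    fun i x => (Complex.abs_im_le_norm _).trans (hn i x).le, fun i => ?_, fun i => ?_,
    fun i x => ?_, fun x => ?_⟩
  · have := integral_re (hint i)
    rw [hzero i] at this
    simpa using this
  · have := integral_im (hint i)
    rw [hzero i] at this
    simpa using this
  · rw [← hn i x, Complex.sq_norm, Complex.normSq_apply]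
    ring
  · rw [Complex.sq_norm, Complex.normSq_apply, Complex.re_sum, Complex.im_sum]
    ring

/-- Cross terms vanish by independence and zero mean, separately for real and imaginary parts; the
diagonal terms recombine to `‖a i‖²`. -/
lemma integral_norm_sum_sq (hz : ∀ i x, ‖z i x‖ = 1) (hm : ∀ i, Measurable (z i))
    (hind : iIndepFun z μ) (h0 : ∀ i, ∫ x, z i x ∂μ = 0) (ha : ∑ i, ‖a i‖ ^ 2 = 1) :
    ∫ x, ‖∑ i, a i * z i x‖ ^ 2 ∂μ = 1 := by
  obtain ⟨X, Y, hX, hY, hXi, hYi, hXb, hYb, hX0, hY0, hsq, he⟩ :=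
    exists_sum_re_im (a := a) hz hm hind h0
  have hint : ∀ {W : Ω → ℝ} {c : ℝ}, Measurable W → (∀ x, |W x| ≤ c) →
      Integrable (fun x => W x ^ 2) μ := by
    intro W c hW hc
    refine Integrable.of_bound (C := c ^ 2) (by fun_prop) (Filter.Eventually.of_forall fun x => ?_)
    rw [norm_pow, Real.norm_eq_abs]
    gcongr
    exact hc x
  have hbs : ∀ {W : ι → Ω → ℝ}, (∀ i x, |W i x| ≤ ‖a i‖) → ∀ x, |∑ i, W i x| ≤ ∑ i, ‖a i‖ :=
    fun hW x => (Finset.abs_sum_le_sum_abs _ _).trans (Finset.sum_le_sum fun i _ => hW i x)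
  simp only [he]
  rw [integral_add (hint (Finset.measurable_fun_sum _ fun i _ => hX i) (hbs hXb))
    (hint (Finset.measurable_fun_sum _ fun i _ => hY i) (hbs hYb)),
    integral_sum_sq hX hXi hXb hX0, integral_sum_sq hY hYi hYb hY0, ← Finset.sum_add_distrib, ← ha]
  refine Finset.sum_congr rfl fun i _ => ?_
  rw [← integral_add (hint (hX i) (hXb i)) (hint (hY i) (hYb i))]
  simp [hsq]

/-- The real and imaginary sums may be dependent, so the exponential is split by the
arithmetic-geometric mean inequality. This doubles the exponents from `1/8` to `1/4`, where each
part has moment at most `√2`. -/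
lemma mgf_norm_sum_sq_le_two (hz : ∀ i x, ‖z i x‖ = 1) (hm : ∀ i, Measurable (z i))
    (hind : iIndepFun z μ) (h0 : ∀ i, ∫ x, z i x ∂μ = 0) (ha : ∑ i, ‖a i‖ ^ 2 = 1) :
    mgf (fun x => ‖∑ i, a i * z i x‖ ^ 2) μ (1 / 8) ≤ 2 := by
  obtain ⟨X, Y, hX, hY, hXi, hYi, hXb, hYb, hX0, hY0, hsq, he⟩ :=
    exists_sum_re_im (a := a) hz hm hind h0
  have hXm : Measurable fun x => ∑ i, X i x := Finset.measurable_fun_sum _ fun i _ => hX i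
  have hYm : Measurable fun x => ∑ i, Y i x := Finset.measurable_fun_sum _ fun i _ => hY i
  have h1 := lintegral_exp_sq_div_four_le hXm (hasSubgaussianMGF_sum hX hXi hXb hX0 ha)
  have h2 := lintegral_exp_sq_div_four_le hYm (hasSubgaussianMGF_sum hY hYi hYb hY0 ha)
  have h3 : ∀ p q : ℝ, Real.exp (1 / 8 * (p ^ 2 + q ^ 2)) ≤
      (1 / 2) * (Real.exp (p ^ 2 / 4) + Real.exp (q ^ 2 / 4)) := by
    intro p q
    have e1 : Real.exp (1 / 8 * (p ^ 2 + q ^ 2)) =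
      Real.exp (p ^ 2 / 8) * Real.exp (q ^ 2 / 8) := by rw [← Real.exp_add]; congr 1; ring
    have e2 : Real.exp (p ^ 2 / 4) = Real.exp (p ^ 2 / 8) ^ 2 := by
      rw [← Real.exp_nat_mul]; congr 1; push_cast; ring
    have e3 : Real.exp (q ^ 2 / 4) = Real.exp (q ^ 2 / 8) ^ 2 := by
      rw [← Real.exp_nat_mul]; congr 1; push_cast; ring
    rw [e1, e2, e3]
    nlinarith [sq_nonneg (Real.exp (p ^ 2 / 8) - Real.exp (q ^ 2 / 8))]
  rw [mgf, integral_eq_lintegral_of_nonneg_ae (Filter.Eventually.of_forall fun _ =>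
    (Real.exp_pos _).le) (integrable_comp_of_continuous hz hm (f := fun t => Real.exp (1 / 8 * t))
      (by fun_prop)).aestronglyMeasurable]
  refine ENNReal.toReal_le_of_le_ofReal zero_le_two ?_
  calc ∫⁻ x, ENNReal.ofReal (Real.exp (1 / 8 * ‖∑ i, a i * z i x‖ ^ 2)) ∂μ
      ≤ ∫⁻ x, ENNReal.ofReal (1 / 2) * (ENNReal.ofReal (Real.exp ((∑ i, X i x) ^ 2 / 4)) +
          ENNReal.ofReal (Real.exp ((∑ i, Y i x) ^ 2 / 4))) ∂μ := by
        refine lintegral_mono fun x => ?_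
        rw [← ENNReal.ofReal_add (Real.exp_pos _).le (Real.exp_pos _).le,
          ← ENNReal.ofReal_mul (by norm_num), he]
        exact ENNReal.ofReal_le_ofReal (h3 _ _)
    _ ≤ ENNReal.ofReal (1 / 2) * (ENNReal.ofReal √2 + ENNReal.ofReal √2) := by
        rw [lintegral_const_mul _ (by fun_prop), lintegral_add_left (by fun_prop)]
        gcongr
    _ ≤ ENNReal.ofReal 2 := by
        rw [← ENNReal.ofReal_add (Real.sqrt_nonneg _) (Real.sqrt_nonneg _),
          ← ENNReal.ofReal_mul (by norm_num)]
        refine ENNReal.ofReal_le_ofReal ?_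
        have : √2 ≤ 2 := by rw [Real.sqrt_le_left zero_le_two]; norm_num
        linarith

/-- For `y ≥ 0`, `exp (-s y) ≤ 1 - s y + (s y)² / 2`, and the quadratic term is dominated by `64 s²
exp (y / 8)`. Mean 1 and the moment bound 2 then give `1 - s + 128 s²`. -/
lemma mgf_norm_sum_sq_neg_le (hz : ∀ i x, ‖z i x‖ = 1) (hm : ∀ i, Measurable (z i))
    (hind : iIndepFun z μ) (h0 : ∀ i, ∫ x, z i x ∂μ = 0) (ha : ∑ i, ‖a i‖ ^ 2 = 1) {s : ℝ}
    (hs : 0 ≤ s) :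
    mgf (fun x => ‖∑ i, a i * z i x‖ ^ 2) μ (-s) ≤ Real.exp (-s + 128 * s ^ 2) := by
  have hpt : ∀ y : ℝ, 0 ≤ y →
      Real.exp (-s * y) ≤ 1 - s * y + 64 * s ^ 2 * Real.exp (1 / 8 * y) := by
    intro y hy
    have hsy : 0 ≤ s * y := mul_nonneg hs hy
    have h1 := Real.quadratic_le_exp_of_nonneg hsy
    have h2 := Real.quadratic_le_exp_of_nonneg (x := 1 / 8 * y) (by positivity)
    -- With `t = s y`, `(1 - t + t²/2)(1 + t + t²/2) = 1 + t⁴/4 ≥ 1`.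
    have h3 : Real.exp (-s * y) ≤ 1 - s * y + (s * y) ^ 2 / 2 := by
      rw [neg_mul, Real.exp_neg, inv_le_iff_one_le_mul₀ (Real.exp_pos _)]
      have h4 : 0 < 1 - s * y + (s * y) ^ 2 / 2 := by nlinarith [sq_nonneg (s * y - 1)]
      calc (1 : ℝ) ≤ (1 - s * y + (s * y) ^ 2 / 2) * (1 + s * y + (s * y) ^ 2 / 2) := by
            nlinarith [sq_nonneg ((s * y) ^ 2)]
        _ ≤ _ := by gcongr
    have h5 : s ^ 2 * (y ^ 2 / 128) ≤ s ^ 2 * Real.exp (1 / 8 * y) := by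
      gcongr
      linarith
    nlinarith
  have hI : ∀ {f : ℝ → ℝ}, Continuous f → Integrable (fun x => f (‖∑ i, a i * z i x‖ ^ 2)) μ :=
    fun hf => integrable_comp_of_continuous hz hm hf
  calc mgf (fun x => ‖∑ i, a i * z i x‖ ^ 2) μ (-s)
      ≤ ∫ x, (1 - s * ‖∑ i, a i * z i x‖ ^ 2 +
          64 * s ^ 2 * Real.exp (1 / 8 * ‖∑ i, a i * z i x‖ ^ 2)) ∂μ :=
        integral_mono (hI (f := fun t => Real.exp (-s * t)) (by fun_prop))
          (hI (f := fun t => 1 - s * t + 64 * s ^ 2 * Real.exp (1 / 8 * t)) (by fun_prop))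
          fun x => hpt _ (by positivity)
    _ = 1 - s + 64 * s ^ 2 * mgf (fun x => ‖∑ i, a i * z i x‖ ^ 2) μ (1 / 8) := by
        rw [integral_add (hI (f := fun t => 1 - s * t) (by fun_prop))
          (hI (f := fun t => 64 * s ^ 2 * Real.exp (1 / 8 * t)) (by fun_prop)),
          integral_sub (integrable_const _) (hI (f := fun t => s * t) (by fun_prop)),
          integral_const_mul, integral_const_mul, integral_norm_sum_sq hz hm hind h0 ha]
        simp [mgf]
    _ ≤ 1 - s + 64 * s ^ 2 * 2 := by
        gcongr
        exact mgf_norm_sum_sq_le_two hz hm hind h0 ha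
    _ ≤ Real.exp (-s + 128 * s ^ 2) := by
        have := Real.add_one_le_exp (-s + 128 * s ^ 2)
        linarith

end Moments

/-! ### Chernoff bounds for sets of messages. -/

lemma sum_intensity_eq {Ω : Type*} {M K d : ℕ} (hK : 0 < K)
    (z : Fin M × Fin K × Fin d → Ω → ℂ) (φ : EuclideanSpace ℂ (Fin d)) (B : Finset (Fin M))
    (x : Ω) : K * ∑ m ∈ B, intensity (fun k ω => z (m, k, ω) x) φ =
      ∑ p ∈ B ×ˢ (Finset.univ : Finset (Fin K)), ‖∑ ω, φ ω * z (p.1, p.2, ω) x‖ ^ 2 := by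
  have hK0 : (K : ℝ) ≠ 0 := by positivity
  rw [Finset.sum_product, Finset.mul_sum]
  refine Finset.sum_congr rfl fun m _ => ?_
  rw [intensity, mul_div_cancel₀ _ hK0]

lemma IsPhaseEnsemble.indep_block {Ω : Type*} [MeasurableSpace Ω] {μ : Measure Ω} {M K d : ℕ}
    {z : Fin M × Fin K × Fin d → Ω → ℂ} (hz : IsPhaseEnsemble μ z) (m : Fin M) (k : Fin K) :
    iIndepFun (fun ω => z (m, k, ω)) μ :=
  hz.indep.precomp (g := fun ω : Fin d => (m, k, ω)) fun a b h => by simpa using h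

section Chernoff

variable {Ω : Type*} [MeasurableSpace Ω] {μ : Measure Ω} [IsProbabilityMeasure μ]

/-- Functions of disjoint blocks of independent variables are independent. -/
lemma mgf_sum_blocks {α β : Type*} [Fintype α] [Fintype β] {z : α × β → Ω → ℂ}
    (hind : iIndepFun z μ) (hm : ∀ i, Measurable (z i)) {g : (β → ℂ) → ℝ} (hg : Measurable g)
    (t : ℝ) (s : Finset α) :
    mgf (fun x => ∑ a ∈ s, g (fun b => z (a, b) x)) μ t =
      ∏ a ∈ s, mgf (fun x => g (fun b => z (a, b) x)) μ t := by
  classical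
  have hgm : ∀ a, Measurable fun x => g (fun b => z (a, b) x) := fun a =>
    hg.comp (measurable_pi_lambda _ fun b => hm _)
  induction s using Finset.induction_on with
  | empty => simp [mgf]
  | insert a s has ih =>
    rw [Finset.prod_insert has, ← ih]
    have hST : Disjoint (Finset.univ.filter fun i : α × β => i.1 = a)
        (Finset.univ.filter fun i : α × β => i.1 ∈ s) := by
      rw [Finset.disjoint_filter]
      rintro i - rfl
      exact has
    have h1 := hind.indepFun_finset _ _ hST hm
    have h2 := h1.comp
      (φ := fun v => g fun b => v ⟨(a, b), by simp⟩)
      (ψ := fun v => ∑ a' : s, g fun b => v ⟨(a'.1, b), by simp⟩)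
      (hg.comp (measurable_pi_lambda _ fun b => measurable_pi_apply _))
      (Finset.measurable_fun_sum _ fun a' _ =>
        hg.comp (measurable_pi_lambda _ fun b => measurable_pi_apply _))
    have h3 : IndepFun (fun x => g fun b => z (a, b) x)
        (fun x => ∑ a' ∈ s, g fun b => z (a', b) x) μ := by
      simp_rw [← Finset.sum_coe_sort s]
      exact h2
    have h4 : Measurable fun x => ∑ a' ∈ s, g fun b => z (a', b) x :=
      Finset.measurable_fun_sum _ fun a' _ => hgm a'
    rw [← h3.mgf_add ((hgm a).const_mul t).exp.aestronglyMeasurable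
      (h4.const_mul t).exp.aestronglyMeasurable]
    congr 1
    funext x
    rw [Finset.sum_insert has]
    rfl

variable {M K d : ℕ} {z : Fin M × Fin K × Fin d → Ω → ℂ}

lemma mgf_sum_intensity_le (hz : IsPhaseEnsemble μ z) (hK : 0 < K)
    {φ : EuclideanSpace ℂ (Fin d)} {t c : ℝ}
    (hc : ∀ m k, mgf (fun x => ‖∑ ω, φ ω * z (m, k, ω) x‖ ^ 2) μ t ≤ c) (B : Finset (Fin M)) :
    mgf (fun x => K * ∑ m ∈ B, intensity (fun k ω => z (m, k, ω) x) φ) μ t ≤ c ^ (B.card * K) := by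
  simp only [sum_intensity_eq hK z]
  have hinj : Function.Injective fun p : (Fin M × Fin K) × Fin d => (p.1.1, p.1.2, p.2) := by
    rintro ⟨⟨a, b⟩, c⟩ ⟨⟨a', b'⟩, c'⟩ h
    simpa [and_assoc] using h
  have h := mgf_sum_blocks (hz.indep.precomp hinj) (fun i => hz.measurable _)
    (g := fun v => ‖∑ ω, φ ω * v ω‖ ^ 2) (by fun_prop) t (B ×ˢ (Finset.univ : Finset (Fin K)))
  refine h.le.trans ?_
  refine (Finset.prod_le_prod (fun p _ => mgf_nonneg) fun p _ => hc p.1 p.2).trans (le_of_eq ?_)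
  simp

lemma integrable_exp_sum_intensity (hz : IsPhaseEnsemble μ z) (φ : EuclideanSpace ℂ (Fin d))
    (B : Finset (Fin M)) (t : ℝ) :
    Integrable (fun x => Real.exp (t * (K * ∑ m ∈ B, intensity (fun k ω => z (m, k, ω) x) φ)))
      μ := by
  have hm := hz.measurable
  have hmeas : Measurable fun x => K * ∑ m ∈ B, intensity (fun k ω => z (m, k, ω) x) φ := by
    unfold intensity
    fun_prop
  refine integrable_exp_mul_of_mem_Icc (a := 0)
    (b := K * ∑ _m ∈ B, (∑ _k : Fin K, (∑ ω, ‖φ ω‖) ^ 2) / K) hmeas.aemeasurable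
    (Filter.Eventually.of_forall fun x => ⟨?_, ?_⟩)
  · exact mul_nonneg (Nat.cast_nonneg _) (Finset.sum_nonneg fun m _ => intensity_nonneg _ _)
  · unfold intensity
    gcongr with m _ k _
    exact norm_sum_mul_le (z := fun ω => z (m, k, ω)) φ (fun ω x => hz.norm_eq_one _ x) x

/-- Lower tail of the intensity. -/
lemma measure_sum_intensity_le (hz : IsPhaseEnsemble μ z) (hK : 0 < K)
    {φ : EuclideanSpace ℂ (Fin d)} (hφ : ‖φ‖ = 1) {η : ℝ} (hη : 0 ≤ η) (B : Finset (Fin M)) :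
    μ.real {x | ∑ m ∈ B, intensity (fun k ω => z (m, k, ω) x) φ ≤ (1 - η) * B.card} ≤
      Real.exp (-(B.card * K * η ^ 2 / 512)) := by
  have hK0 : (0 : ℝ) < K := by positivity
  have hφ2 : ∑ ω, ‖φ ω‖ ^ 2 = 1 := by rw [← EuclideanSpace.norm_sq_eq, hφ, one_pow]
  -- The choice `s = η / 256` minimizes `-s η + 128 s²`, with value `-η² / 512`.
  have h0 : ∀ m k, mgf (fun x => ‖∑ ω, φ ω * z (m, k, ω) x‖ ^ 2) μ (-(η / 256)) ≤
      Real.exp (-(η / 256) + 128 * (η / 256) ^ 2) := fun m k =>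
    mgf_norm_sum_sq_neg_le (z := fun ω => z (m, k, ω)) (a := φ) (fun ω x => hz.norm_eq_one _ x)
      (fun ω => hz.measurable _) (hz.indep_block m k) (fun ω => hz.mean_zero _) hφ2 (by positivity)
  have h1 := mgf_sum_intensity_le hz hK h0 B
  have h2 := measure_le_le_exp_mul_mgf (μ := μ) (t := -(η / 256)) (K * ((1 - η) * B.card))
    (by linarith) (integrable_exp_sum_intensity hz φ B (-(η / 256)))
  have hset : {x | ∑ m ∈ B, intensity (fun k ω => z (m, k, ω) x) φ ≤ (1 - η) * B.card} =
      {x | K * ∑ m ∈ B, intensity (fun k ω => z (m, k, ω) x) φ ≤ K * ((1 - η) * B.card)} := by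
    ext x
    exact (mul_le_mul_iff_right₀ hK0).symm
  rw [hset]
  refine h2.trans ((mul_le_mul_of_nonneg_left h1 (Real.exp_pos _).le).trans (le_of_eq ?_))
  rw [← Real.exp_nat_mul, ← Real.exp_add]
  congr 1
  push_cast
  ring

/-- Upper tail of the intensity. -/
lemma measure_le_sum_intensity (hz : IsPhaseEnsemble μ z) (hK : 0 < K)
    {φ : EuclideanSpace ℂ (Fin d)} (hφ : ‖φ‖ = 1) (B : Finset (Fin M)) :
    μ.real {x | 16 * (B.card : ℝ) ≤ ∑ m ∈ B, intensity (fun k ω => z (m, k, ω) x) φ} ≤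
      Real.exp (-(B.card * K)) := by
  have hK0 : (0 : ℝ) < K := by positivity
  have hφ2 : ∑ ω, ‖φ ω‖ ^ 2 = 1 := by rw [← EuclideanSpace.norm_sq_eq, hφ, one_pow]
  -- Per codeword the exponent is `1 - 16 / 8 = -1`, which explains the threshold 16.
  have h0 : ∀ m k, mgf (fun x => ‖∑ ω, φ ω * z (m, k, ω) x‖ ^ 2) μ (1 / 8) ≤ Real.exp 1 :=
    fun m k => (mgf_norm_sum_sq_le_two (z := fun ω => z (m, k, ω)) (a := φ)
      (fun ω x => hz.norm_eq_one _ x) (fun ω => hz.measurable _) (hz.indep_block m k)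
      (fun ω => hz.mean_zero _) hφ2).trans (by have := Real.exp_one_gt_d9; linarith)
  have h1 := mgf_sum_intensity_le hz hK h0 B
  have h2 := measure_ge_le_exp_mul_mgf (μ := μ) (t := 1 / 8) (K * (16 * (B.card : ℝ)))
    (by norm_num) (integrable_exp_sum_intensity hz φ B (1 / 8))
  have hset : {x | 16 * (B.card : ℝ) ≤ ∑ m ∈ B, intensity (fun k ω => z (m, k, ω) x) φ} =
      {x | K * (16 * (B.card : ℝ)) ≤ K * ∑ m ∈ B, intensity (fun k ω => z (m, k, ω) x) φ} := by
    ext x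
    exact (mul_le_mul_iff_right₀ hK0).symm
  rw [hset]
  refine h2.trans ((mul_le_mul_of_nonneg_left h1 (Real.exp_pos _).le).trans (le_of_eq ?_))
  rw [← Real.exp_nat_mul, ← Real.exp_add]
  congr 1
  push_cast
  ring

end Chernoff

/-! ### Nets of the unit sphere. -/

/-- Volume bound for separated subsets of the unit sphere. -/
lemma card_le_of_separated {E : Type*} [NormedAddCommGroup E] [NormedSpace ℝ E]
    [FiniteDimensional ℝ E] {ε : ℝ} (hε : 0 < ε) (hε1 : ε ≤ 1) (s : Finset E)
    (hs : ∀ c ∈ s, ‖c‖ = 1) (h : ∀ c ∈ s, ∀ d ∈ s, c ≠ d → ε ≤ ‖c - d‖) :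
    (s.card : ℝ) ≤ (3 / ε) ^ Module.finrank ℝ E := by
  borelize E
  let μ : Measure E := Measure.addHaar
  have hε2 : 0 < ε / 2 := by positivity
  have hρ : (0 : ℝ) < 3 / 2 := by norm_num
  have D : Set.PairwiseDisjoint (s : Set E) fun c => Metric.ball c (ε / 2) := by
    intro c hc d hd hcd
    refine Metric.ball_disjoint_ball ?_
    rw [dist_eq_norm, add_halves]
    exact h c hc d hd hcd
  have hsub : (⋃ c ∈ s, Metric.ball c (ε / 2)) ⊆ Metric.ball (0 : E) (3 / 2) := by
    refine Set.iUnion₂_subset fun c hc => Metric.ball_subset_ball' ?_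
    rw [dist_zero_right, hs c hc]
    linarith
  have I : (s.card : ENNReal) * ENNReal.ofReal ((ε / 2) ^ Module.finrank ℝ E) *
      μ (Metric.ball 0 1) ≤
      ENNReal.ofReal ((3 / 2) ^ Module.finrank ℝ E) * μ (Metric.ball 0 1) := by
    rw [← μ.addHaar_ball_of_pos 0 hρ]
    refine le_trans (le_of_eq ?_) (measure_mono hsub)
    rw [measure_biUnion_finset D fun c _ => measurableSet_ball]
    simp only [μ.addHaar_ball_of_pos _ hε2, Finset.sum_const, nsmul_eq_mul, mul_assoc]
  have J := (ENNReal.mul_le_mul_iff_left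
    (Metric.measure_ball_pos μ (0 : E) zero_lt_one).ne' measure_ball_lt_top.ne).1 I
  have K := ENNReal.toReal_le_of_le_ofReal (by positivity) J
  rw [ENNReal.toReal_mul, ENNReal.toReal_natCast, ENNReal.toReal_ofReal (by positivity)] at K
  rw [← le_div_iff₀ (by positivity), ← div_pow] at K
  refine K.trans (le_of_eq ?_)
  congr 1
  field_simp

/-- The unit sphere of `ℂ^d` has an `ε`-net of cardinality at most `(3 / ε) ^ (2 d)`. -/
lemma exists_sphere_net (d : ℕ) {ε : ℝ} (hε : 0 < ε) (hε1 : ε ≤ 1) :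
    ∃ N : Finset (EuclideanSpace ℂ (Fin d)), (∀ φ ∈ N, ‖φ‖ = 1) ∧
      (∀ φ : EuclideanSpace ℂ (Fin d), ‖φ‖ = 1 → ∃ ψ ∈ N, ‖ψ - φ‖ ≤ ε) ∧
      (N.card : ℝ) ≤ (3 / ε) ^ (2 * d) := by
  classical
  have hfin : Module.finrank ℝ (EuclideanSpace ℂ (Fin d)) = 2 * d := by
    rw [finrank_real_of_complex, finrank_euclideanSpace, Fintype.card_fin]
  -- The volume bound caps the size of separated sets, so a largest one exists. It is a net: a point
  -- farther than `ε` from it could be added.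
  let P : ℕ → Prop := fun n => ∃ s : Finset (EuclideanSpace ℂ (Fin d)), s.card = n ∧
    (∀ c ∈ s, ‖c‖ = 1) ∧ ∀ c ∈ s, ∀ d ∈ s, c ≠ d → ε ≤ ‖c - d‖
  have hP : ∀ n, P n → (n : ℝ) ≤ (3 / ε) ^ (2 * d) := by
    rintro n ⟨s, rfl, h1, h2⟩
    rw [← hfin]
    exact card_le_of_separated hε hε1 s h1 h2
  have hspec : P (Nat.findGreatest P ⌊(3 / ε) ^ (2 * d)⌋₊) :=
    Nat.findGreatest_spec (Nat.zero_le _) ⟨∅, by simp⟩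
  have hmax : ∀ n, P n → n ≤ Nat.findGreatest P ⌊(3 / ε) ^ (2 * d)⌋₊ := fun n hn =>
    Nat.le_findGreatest (Nat.le_floor (hP n hn)) hn
  have hbound := hP _ hspec
  obtain ⟨N, hN, h1, h2⟩ := hspec
  refine ⟨N, h1, fun φ hφ => ?_, by rw [hN]; exact hbound⟩
  by_contra! hcon
  have hφN : φ ∉ N := fun h => by
    have := hcon φ h
    rw [sub_self, norm_zero] at this
    linarith
  have h3 := hmax (N.card + 1) ⟨insert φ N, Finset.card_insert_of_notMem hφN, ?_, ?_⟩
  · omega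
  · simpa [hφ] using h1
  · intro c hc e he hce
    rcases Finset.mem_insert.1 hc with hc' | hc' <;> rcases Finset.mem_insert.1 he with he' | he'
    · exact absurd (hc'.trans he'.symm) hce
    · rw [hc', norm_sub_rev]
      exact (hcon e he').le
    · rw [he']
      exact (hcon c hc').le
    · exact h2 c hc' e he' hce

/-- The norm of a linear map is controlled by its values on a net. -/
lemma opNorm_le_of_net {d : ℕ} {F : Type*} [NormedAddCommGroup F] [NormedSpace ℂ F]
    (T : EuclideanSpace ℂ (Fin d) →L[ℂ] F) {N : Finset (EuclideanSpace ℂ (Fin d))} {ε C : ℝ}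
    (hε : ε ≤ 1 / 2) (hC : 0 ≤ C)
    (hN : ∀ φ : EuclideanSpace ℂ (Fin d), ‖φ‖ = 1 → ∃ ψ ∈ N, ‖ψ - φ‖ ≤ ε)
    (hT : ∀ ψ ∈ N, ‖T ψ‖ ≤ C) : ‖T‖ ≤ 2 * C := by
  have h1 : ∀ φ : EuclideanSpace ℂ (Fin d), ‖φ‖ = 1 → ‖T φ‖ ≤ C + ‖T‖ / 2 := by
    intro φ hφ
    obtain ⟨ψ, hψ, hd⟩ := hN φ hφ
    calc ‖T φ‖ = ‖T ψ - T (ψ - φ)‖ := by rw [map_sub, sub_sub_cancel]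
      _ ≤ ‖T ψ‖ + ‖T (ψ - φ)‖ := norm_sub_le _ _
      _ ≤ C + ‖T‖ * (1 / 2) :=
        add_le_add (hT ψ hψ) ((T.le_opNorm _).trans (by gcongr; exact hd.trans hε))
      _ = C + ‖T‖ / 2 := by ring
  have h2 : ‖T‖ ≤ C + ‖T‖ / 2 := by
    refine T.opNorm_le_bound (by positivity) fun φ => ?_
    rcases eq_or_ne φ 0 with rfl | hφ
    · simp
    have hn : 0 < ‖φ‖ := norm_pos_iff.2 hφ
    have h3 := h1 (((‖φ‖⁻¹ : ℝ) : ℂ) • φ) (by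
      rw [norm_smul, Complex.norm_real, norm_inv, norm_norm, inv_mul_cancel₀ hn.ne'])
    rw [map_smul, norm_smul, Complex.norm_real, norm_inv, norm_norm, inv_mul_le_iff₀ hn] at h3
    linarith
  linarith

/-! ### From the net to every direction. -/

lemma intensity_smul {K d : ℕ} (u : Fin K → Fin d → ℂ) (c : ℂ) (φ : EuclideanSpace ℂ (Fin d)) :
    intensity u (c • φ) = ‖c‖ ^ 2 * intensity u φ := by
  simp only [intensity, PiLp.smul_apply, smul_eq_mul, mul_assoc, ← Finset.mul_sum, norm_mul,
    mul_pow, mul_div_assoc]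

lemma intensity_le_add {K d : ℕ} (u : Fin K → Fin d → ℂ) {η : ℝ} (hη : 0 < η)
    (φ ψ : EuclideanSpace ℂ (Fin d)) :
    intensity u ψ ≤ (1 + η) * intensity u φ + (1 + 1 / η) * intensity u (ψ - φ) := by
  have h : ∀ p q : ℂ, ‖p‖ ^ 2 ≤ (1 + η) * ‖q‖ ^ 2 + (1 + 1 / η) * ‖p - q‖ ^ 2 := by
    intro p q
    have h1 : ‖p‖ ≤ ‖q‖ + ‖p - q‖ := by
      simpa using norm_add_le q (p - q)
    have h2 : ‖p‖ ^ 2 ≤ (‖q‖ + ‖p - q‖) ^ 2 := by gcongr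
    have h3 : (1 + η) * ‖q‖ ^ 2 + (1 + 1 / η) * ‖p - q‖ ^ 2 - (‖q‖ + ‖p - q‖) ^ 2 =
        (η * ‖q‖ - ‖p - q‖) ^ 2 / η := by
      field_simp
      ring
    have h4 : 0 ≤ (η * ‖q‖ - ‖p - q‖) ^ 2 / η := by positivity
    linarith
  simp only [intensity, mul_div_assoc']
  rw [← add_div, Finset.mul_sum, Finset.mul_sum, ← Finset.sum_add_distrib]
  refine div_le_div_of_nonneg_right (Finset.sum_le_sum fun k _ => ?_) (Nat.cast_nonneg _)
  refine (h _ (∑ ω, φ ω * u k ω)).trans (le_of_eq ?_)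
  simp only [PiLp.sub_apply, sub_mul, Finset.sum_sub_distrib]

/-- The summed intensity times `K` is `‖T φ‖²` for the linear map `T` to the amplitudes indexed by
`(m, k)`. Passing from the net to the sphere doubles the bound on `‖T‖`, turning 16 into 64. -/
lemma sum_intensity_le_of_net {M K d : ℕ} (hK : 0 < K) (u : Fin M → Fin K → Fin d → ℂ)
    (S : Finset (Fin M)) {N : Finset (EuclideanSpace ℂ (Fin d))} {ε : ℝ} (hε : ε ≤ 1 / 2)
    (hN : ∀ φ : EuclideanSpace ℂ (Fin d), ‖φ‖ = 1 → ∃ ψ ∈ N, ‖ψ - φ‖ ≤ ε)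
    (hup : ∀ ψ ∈ N, ∑ m ∈ S, intensity (u m) ψ ≤ 16 * S.card) (φ : EuclideanSpace ℂ (Fin d)) :
    ∑ m ∈ S, intensity (u m) φ ≤ 64 * S.card * ‖φ‖ ^ 2 := by
  have hK0 : (0 : ℝ) < K := by positivity
  let A : Matrix ({m // m ∈ S} × Fin K) (Fin d) ℂ := fun p ω => u p.1 p.2 ω
  let T := LinearMap.toContinuousLinearMap (Matrix.toEuclideanLin A)
  have hT : ∀ φ, ‖T φ‖ ^ 2 = K * ∑ m ∈ S, intensity (u m) φ := by
    intro φ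
    rw [EuclideanSpace.norm_sq_eq, Fintype.sum_prod_type, Finset.mul_sum,
      ← Finset.sum_coe_sort S]
    refine Finset.sum_congr rfl fun m _ => ?_
    rw [intensity, mul_div_cancel₀ _ hK0.ne']
    refine Finset.sum_congr rfl fun k _ => ?_
    have h : T φ (m, k) = ∑ ω, u m k ω * φ ω := rfl
    simp only [h, mul_comm]
  have h1 : ‖T‖ ≤ 2 * √(K * (16 * S.card)) := by
    refine opNorm_le_of_net T hε (Real.sqrt_nonneg _) hN fun ψ hψ => ?_
    refine Real.le_sqrt_of_sq_le ?_
    rw [hT]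
    exact mul_le_mul_of_nonneg_left (hup ψ hψ) hK0.le
  have h2 : ‖T φ‖ ^ 2 ≤ (2 * √(K * (16 * S.card)) * ‖φ‖) ^ 2 := by
    gcongr
    exact (T.le_opNorm φ).trans (by gcongr)
  rw [hT, mul_pow, mul_pow, Real.sq_sqrt (by positivity)] at h2
  refine le_of_mul_le_mul_left (h2.trans (le_of_eq ?_)) hK0
  ring

/-- Control of the intensities on a net gives control in every direction. -/
lemma card_filter_intensity_lt_le {M K d : ℕ} (hK : 0 < K) (u : Fin M → Fin K → Fin d → ℂ)
    (S : Finset (Fin M)) {N : Finset (EuclideanSpace ℂ (Fin d))} {ε η : ℝ}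
    (hε : ε ≤ 1 / 2) (hη : 0 < η) (hεη : 64 * ε ^ 2 ≤ η ^ 3)
    (hN : ∀ φ : EuclideanSpace ℂ (Fin d), ‖φ‖ = 1 → ∃ ψ ∈ N, ‖ψ - φ‖ ≤ ε)
    (hup : ∀ ψ ∈ N, ∑ m ∈ S, intensity (u m) ψ ≤ 16 * S.card)
    (hlow : ∀ ψ ∈ N, ∀ B ⊆ S, η * S.card < B.card →
      (1 - η) * B.card < ∑ m ∈ B, intensity (u m) ψ) (φ : EuclideanSpace ℂ (Fin d)) :
    ((S.filter fun m => intensity (u m) φ < (1 - 4 * η) * ‖φ‖ ^ 2).card : ℝ) ≤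
      4 * η * S.card := by
  have unit : ∀ φ : EuclideanSpace ℂ (Fin d), ‖φ‖ = 1 →
      ((S.filter fun m => intensity (u m) φ < 1 - 4 * η).card : ℝ) ≤ 4 * η * S.card := by
    intro φ hφ
    obtain ⟨ψ, hψ, hd⟩ := hN φ hφ
    have hB1 : ((S.filter fun m => intensity (u m) ψ ≤ 1 - η).card : ℝ) ≤ η * S.card := by
      by_contra! hcon
      have h1 := hlow ψ hψ _ (Finset.filter_subset _ _) hcon
      have h2 := Finset.sum_le_card_nsmul (S.filter fun m => intensity (u m) ψ ≤ 1 - η)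
        (fun m => intensity (u m) ψ) (1 - η) fun m hm => (Finset.mem_filter.1 hm).2
      rw [nsmul_eq_mul] at h2
      linarith
    -- Markov's inequality: the total is at most `64 |S| ε² ≤ η³ |S|`.
    have hB2 : ((S.filter fun m => η ^ 2 < intensity (u m) (ψ - φ)).card : ℝ) ≤ η * S.card := by
      have h1 := Finset.card_nsmul_le_sum (S.filter fun m => η ^ 2 < intensity (u m) (ψ - φ))
        (fun m => intensity (u m) (ψ - φ)) (η ^ 2) fun m hm => (Finset.mem_filter.1 hm).2.le
      have h2 : ∑ m ∈ S.filter (fun m => η ^ 2 < intensity (u m) (ψ - φ)),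
          intensity (u m) (ψ - φ) ≤ ∑ m ∈ S, intensity (u m) (ψ - φ) :=
        Finset.sum_le_sum_of_subset_of_nonneg (Finset.filter_subset _ _)
          fun m _ _ => intensity_nonneg _ _
      have h3 := sum_intensity_le_of_net hK u S hε hN hup (ψ - φ)
      have h4 : ‖ψ - φ‖ ^ 2 ≤ ε ^ 2 := by gcongr
      have hS : (0 : ℝ) ≤ S.card := Nat.cast_nonneg _
      rw [nsmul_eq_mul] at h1
      refine le_of_mul_le_mul_right ?_ (pow_pos hη 2)
      nlinarith [mul_le_mul_of_nonneg_left h4 hS, mul_le_mul_of_nonneg_left hεη hS]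
    -- Outside both exceptional sets, an intensity below `1 - 4η` along `φ` would force `1 - η < (1
    -- + η)(1 - 4η) + η² + η`, which is false.
    have hsub : (S.filter fun m => intensity (u m) φ < 1 - 4 * η) ⊆
        (S.filter fun m => intensity (u m) ψ ≤ 1 - η) ∪
          (S.filter fun m => η ^ 2 < intensity (u m) (ψ - φ)) := by
      intro m hm
      obtain ⟨hmS, hm⟩ := Finset.mem_filter.1 hm
      by_contra hcon
      simp only [Finset.mem_union, Finset.mem_filter, hmS, true_and, not_or, not_le, not_lt] at hcon
      have h1 := intensity_le_add (u m) hη φ ψ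
      have h2 : (1 + 1 / η) * intensity (u m) (ψ - φ) ≤ (1 + 1 / η) * η ^ 2 := by
        gcongr
        exact hcon.2
      have h3 : (1 + 1 / η) * η ^ 2 = η ^ 2 + η := by
        field_simp
      have h4 : (1 + η) * intensity (u m) φ ≤ (1 + η) * (1 - 4 * η) := by gcongr
      nlinarith [hcon.1, sq_nonneg η]
    have hc := (Finset.card_le_card hsub).trans (Finset.card_union_le _ _)
    have hc' : ((S.filter fun m => intensity (u m) φ < 1 - 4 * η).card : ℝ) ≤
        (S.filter fun m => intensity (u m) ψ ≤ 1 - η).card +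
          (S.filter fun m => η ^ 2 < intensity (u m) (ψ - φ)).card := by exact_mod_cast hc
    have hS : (0 : ℝ) ≤ η * S.card := by positivity
    linarith
  rcases eq_or_ne φ 0 with rfl | hφ
  · rw [Finset.filter_false_of_mem]
    · rw [Finset.card_empty, Nat.cast_zero]
      positivity
    · intro m _
      have := intensity_nonneg (u m) 0
      simpa using this
  · have hn : 0 < ‖φ‖ := norm_pos_iff.2 hφ
    have h := unit (((‖φ‖⁻¹ : ℝ) : ℂ) • φ) (by
      rw [norm_smul, Complex.norm_real, norm_inv, norm_norm, inv_mul_cancel₀ hn.ne'])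
    simp only [intensity_smul, Complex.norm_real, norm_inv, norm_norm, inv_pow,
      inv_mul_lt_iff₀ (pow_pos hn 2)] at h
    simpa only [mul_comm] using h

/-! ### Union bound over directions and message sets. -/

section Failure

variable {Ω : Type*} [MeasurableSpace Ω] {μ : Measure Ω}
  {M K d : ℕ} {z : Fin M × Fin K × Fin d → Ω → ℂ}

/-- The event that the intensities of the messages in `B` along `φ` deviate from their means. -/
def deviation {Ω : Type*} {M K d : ℕ} (z : Fin M × Fin K × Fin d → Ω → ℂ) (N : ℕ) (η : ℝ)
    (φ : EuclideanSpace ℂ (Fin d)) (B : Finset (Fin M)) : Set Ω :=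
  {x | η * N < B.card ∧
      ∑ m ∈ B, intensity (fun k ω => z (m, k, ω) x) φ ≤ (1 - η) * B.card} ∪
    {x | B.card = N ∧
      16 * (B.card : ℝ) ≤ ∑ m ∈ B, intensity (fun k ω => z (m, k, ω) x) φ}

/-- In the lower tail, `|B| > η N` supplies the third factor `η`; in the upper tail, `η³ ≤ 1`
weakens the exponent to the same form. -/
lemma measure_deviation_le [IsProbabilityMeasure μ] (hz : IsPhaseEnsemble μ z) (hK : 0 < K)
    {φ : EuclideanSpace ℂ (Fin d)} (hφ : ‖φ‖ = 1) (N : ℕ) {η : ℝ} (hη : 0 ≤ η) (hη1 : η ≤ 1)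
    (B : Finset (Fin M)) :
    μ.real (deviation z N η φ B) ≤ 2 * Real.exp (-(N * K * η ^ 3 / 512)) := by
  rw [two_mul]
  refine (measureReal_union_le _ _).trans (add_le_add ?_ ?_)
  · by_cases hB : η * N < B.card
    · simp only [hB, true_and]
      refine (measure_sum_intensity_le hz hK hφ hη B).trans (Real.exp_le_exp.2 ?_)
      have : η * N * (K * η ^ 2) ≤ B.card * (K * η ^ 2) := by gcongr
      linarith
    · simp [hB, (Real.exp_pos _).le]
  · by_cases hB : B.card = N
    · simp only [hB, true_and]
      have h := measure_le_sum_intensity hz hK hφ B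
      rw [hB] at h
      refine h.trans (Real.exp_le_exp.2 ?_)
      have h1 : η ^ 3 ≤ 1 := pow_le_one₀ hη hη1
      have h2 : (N : ℝ) * K * η ^ 3 ≤ N * K * 1 := by gcongr
      have h3 : (0 : ℝ) ≤ N * K := by positivity
      linarith
    · simp [hB, (Real.exp_pos _).le]

/-- Lets the union bound index sets of at most `N` messages by functions `Fin N → Fin M`, of which
there are `M ^ N`. -/
lemma exists_image_eq {α : Type*} [DecidableEq α] {B : Finset α} (hB : B.Nonempty) {N : ℕ}
    (hN : B.card ≤ N) : ∃ f : Fin N → α, Finset.univ.image f = B := by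
  have : Nonempty B := hB.to_subtype
  obtain ⟨e⟩ : Nonempty (B ↪ Fin N) := Function.Embedding.nonempty_of_card_le (by simpa using hN)
  refine ⟨fun i => (Function.invFun e i : B), ?_⟩
  ext b
  simp only [Finset.mem_image, Finset.mem_univ, true_and]
  constructor
  · rintro ⟨i, rfl⟩
    exact (Function.invFun e i).2
  · intro hb
    exact ⟨e ⟨b, hb⟩, by rw [Function.leftInverse_invFun e.injective]⟩

lemma IsBitLeak.card_eq {n N : ℕ} {L : Fin M → Fin n → Bool} (hL : IsBitLeak L)
    (hM : M = N * 2 ^ n) (v : Fin n → Bool) : (Finset.univ.filter fun m => L m = v).card = N :=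
  Nat.eq_of_mul_eq_mul_right (pow_pos two_pos n) ((hL v).trans hM)

lemma logb_sub_eq {n N : ℕ} (hM : M = N * 2 ^ n) (hN : 0 < N) :
    Real.logb 2 M - n = Real.logb 2 N := by
  have h2 : (2 : ℝ) ^ n ≠ 0 := by positivity
  rw [hM, Nat.cast_mul, Nat.cast_pow, Nat.cast_ofNat, Real.logb_mul (by positivity) h2,
    Real.logb_pow, Real.logb_self_eq_one one_lt_two, mul_one, add_sub_cancel_right]

/-- If the intensities along a net do not deviate, then Eve has little accessible information. -/
lemma leakFailure_subset (hz : IsPhaseEnsemble μ z) (hK : 0 < K) (hd : 0 < d) {n N : ℕ} {δ : ℝ}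
    (hM : M = N * 2 ^ n) (hN : 2 ≤ N) (hδ : 0 < δ) (hδ1 : 320 * δ < 1)
    {net : Finset (EuclideanSpace ℂ (Fin d))}
    (hnet : ∀ φ : EuclideanSpace ℂ (Fin d), ‖φ‖ = 1 → ∃ ψ ∈ net, ‖ψ - φ‖ ≤ δ ^ 2) :
    leakFailure z n (320 * (δ * (Real.logb 2 M - n))) ⊆
      ⋃ φ ∈ net, ⋃ f ∈ (Finset.univ : Finset (Fin N → Fin M)),
        deviation z N (20 * δ) φ (Finset.univ.image f) := by
  rintro x ⟨L, hL, v, hx⟩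
  by_contra hcon
  simp only [Set.mem_iUnion, Finset.mem_univ, exists_prop, true_and, not_exists, not_and,
    deviation, Set.mem_union, Set.mem_ofPred_eq, not_or, not_le] at hcon
  set S := Finset.univ.filter fun m => L m = v with hSdef
  have hS : S.card = N := hL.card_eq hM v
  have hup : ∀ ψ ∈ net, ∑ m ∈ S, intensity (fun k ω => z (m, k, ω) x) ψ ≤ 16 * S.card := by
    intro ψ hψ
    obtain ⟨f, hf⟩ := exists_image_eq (B := S) (Finset.card_pos.1 (by omega)) hS.le
    have h := (hcon ψ hψ f).2
    rw [hf] at h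
    exact (h hS).le
  have hlow : ∀ ψ ∈ net, ∀ B ⊆ S, 20 * δ * S.card < B.card →
      (1 - 20 * δ) * B.card < ∑ m ∈ B, intensity (fun k ω => z (m, k, ω) x) ψ := by
    intro ψ hψ B hBS hB
    have hB0 : B.Nonempty := by
      rw [← Finset.card_pos]
      have : (0 : ℝ) < B.card := lt_of_le_of_lt (by positivity) hB
      exact_mod_cast this
    obtain ⟨f, hf⟩ := exists_image_eq hB0 ((Finset.card_le_card hBS).trans hS.le)
    have h := (hcon ψ hψ f).1
    rw [hf] at h
    exact h (hS ▸ hB)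
  have hδ2 : δ ^ 2 ≤ 1 / 2 := by nlinarith
  have hδ3 : 64 * (δ ^ 2) ^ 2 ≤ (20 * δ) ^ 3 := by
    have h3 : 0 < δ ^ 3 := by positivity
    nlinarith
  -- With `η = 20 δ` the bad fraction is `θ = 4η = 80 δ`, and `4θ = 320 δ` is the constant of the
  -- theorem.
  have hacc := accInfo_cqState_le hK hd (fun m k ω => z (m, k, ω) x)
    (fun m k ω => hz.norm_eq_one _ x) S (hS ▸ hN) (θ := 4 * (20 * δ)) (by positivity)
    (by linarith)
    (card_filter_intensity_lt_le hK (fun m k ω => z (m, k, ω) x) S hδ2 (by positivity) hδ3 hnet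
      hup hlow)
  refine absurd (hx.trans_le hacc) (not_lt.2 (EReal.coe_le_coe_iff.2 (le_of_eq ?_)))
  rw [logb_sub_eq hM (by omega), hS]
  ring

lemma measure_leakFailure_le [IsProbabilityMeasure μ] (hz : IsPhaseEnsemble μ z) (hK : 0 < K)
    (hd : 0 < d) {n N : ℕ} {δ : ℝ} (hM : M = N * 2 ^ n) (hN : 2 ≤ N) (hδ : 0 < δ)
    (hδ1 : 320 * δ < 1) :
    μ (leakFailure z n (320 * (δ * (Real.logb 2 M - n)))) ≤
      ENNReal.ofReal ((3 / δ ^ 2) ^ (2 * d) * ((M : ℝ) ^ N *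
        (2 * Real.exp (-(N * K * (20 * δ) ^ 3 / 512))))) := by
  obtain ⟨net, hnet1, hnet, hcard⟩ := exists_sphere_net d (ε := δ ^ 2) (by positivity)
    (by nlinarith)
  rw [← ofReal_measureReal (by finiteness)]
  refine ENNReal.ofReal_le_ofReal ?_
  refine (measureReal_mono (leakFailure_subset hz hK hd hM hN hδ hδ1 hnet)
    (measure_ne_top _ _)).trans ?_
  refine (measureReal_biUnion_finset_le _ _).trans ?_
  have h1 : ∀ φ ∈ net, μ.real (⋃ f ∈ (Finset.univ : Finset (Fin N → Fin M)),
      deviation z N (20 * δ) φ (Finset.univ.image f)) ≤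
      (M : ℝ) ^ N * (2 * Real.exp (-(N * K * (20 * δ) ^ 3 / 512))) := by
    intro φ hφ
    refine (measureReal_biUnion_finset_le _ _).trans ?_
    refine (Finset.sum_le_card_nsmul _ _ _ fun f _ => measure_deviation_le hz hK (hnet1 φ hφ) N
      (by positivity) (by linarith) _).trans (le_of_eq ?_)
    simp
  refine (Finset.sum_le_card_nsmul _ _ _ h1).trans ?_
  rw [nsmul_eq_mul]
  gcongr

/-- A single remaining message carries no information, and for `320 δ ≥ 1` the threshold already
exceeds the trivial bound `log N`. -/
lemma leakFailure_eq_empty (hz : IsPhaseEnsemble μ z) (hK : 0 < K) (hd : 0 < d) {n N : ℕ} {δ : ℝ}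
    (hM : M = N * 2 ^ n) (hN : 0 < N) (h : N = 1 ∨ 1 ≤ 320 * δ) :
    leakFailure z n (320 * (δ * (Real.logb 2 M - n))) = ∅ := by
  refine Set.eq_empty_of_forall_notMem ?_
  rintro x ⟨L, hL, v, hx⟩
  have hS := hL.card_eq hM v
  have hacc := accInfo_cqState_le_logb_card hK hd (fun m k ω => z (m, k, ω) x)
    (fun m k ω => hz.norm_eq_one _ x) (Finset.univ.filter fun m => L m = v)
    (Finset.card_pos.1 (by omega))
  refine absurd (hx.trans_le hacc) (not_lt.2 (EReal.coe_le_coe_iff.2 ?_))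
  rw [logb_sub_eq hM hN, hS]
  have hL0 : 0 ≤ Real.logb 2 N := Real.logb_nonneg one_lt_two (by exact_mod_cast hN)
  rcases h with rfl | h
  · simp
  · nlinarith

end Failure

/-! ### Key sizes. -/

lemma nat_cast_le_log {M n : ℕ} (hM : 0 < M) (h : 2 ^ n ∣ M) :
    (n : ℝ) * Real.log 2 ≤ Real.log M := by
  rw [← Real.log_pow]
  refine Real.log_le_log (by positivity) ?_
  exact_mod_cast Nat.le_of_dvd hM h

/-- The expression in brackets in the lower bound on the key size is bounded below. -/
lemma half_log_add_le {d M n N : ℕ} {δ : ℝ} (hM : M = N * 2 ^ n) (hN : 2 ≤ N) (hδ : 0 < δ)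
    (hδ1 : 320 * δ < 1) :
    Real.log M / 2 + 2 * d / N * Real.log (5 / δ) ≤
      Real.log M + δ * (Real.log M - n) + 2 ^ (n + 1) * (d / M) * Real.log (5 / δ) := by
  have hM0 : 0 < M := by rw [hM]; positivity
  have hn := nat_cast_le_log hM0 (Dvd.intro_left N hM.symm)
  have hl2 := Real.log_two_gt_d9
  have hn0 : (0 : ℝ) ≤ n := Nat.cast_nonneg n
  have hN0 : (N : ℝ) ≠ 0 := by positivity
  have e : (2 : ℝ) ^ (n + 1) * (d / M) = 2 * d / N := by
    rw [hM]
    push_cast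
    field_simp
    ring
  rw [e]
  -- `Real.log M - n` mixes nats with bits and can be negative. It is at least `-Real.log M`, so
  -- after multiplication by `δ < 1/320` it costs less than half of `Real.log M`.
  have h1 : (n : ℝ) ≤ 2 * Real.log M := by nlinarith
  have h2 : 0 ≤ Real.log M := Real.log_natCast_nonneg M
  have h3 : -Real.log M ≤ Real.log M - n := by linarith
  have h4 := mul_le_mul_of_nonneg_left h3 hδ.le
  have h5 : 320 * δ * Real.log M ≤ 1 * Real.log M := by gcongr
  linarith

/-- Above the lower bound on the key size, the union bound is overwhelmed. -/
lemma union_bound_le {d M K n N : ℕ} {δ : ℝ} (hM : M = N * 2 ^ n) (hN : 2 ≤ N)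
    (hδ : 0 < δ) (hδ1 : 320 * δ < 1)
    (hT : Real.log M / 2 + 2 * d / N * Real.log (5 / δ) ≤ δ ^ 3 * K / 4) :
    (3 / δ ^ 2) ^ (2 * d) * ((M : ℝ) ^ N * (2 * Real.exp (-(N * K * (20 * δ) ^ 3 / 512)))) ≤
      Real.exp (-(N * (δ ^ 3 * K / 4))) := by
  have hN0 : (0 : ℝ) < N := by positivity
  have hM0 : (0 : ℝ) < M := by rw [hM]; positivity
  have hD : 0 < 5 / δ := by positivity
  have e1 : (3 / δ ^ 2) ^ (2 * d) ≤ Real.exp (4 * d * Real.log (5 / δ)) := by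
    have : 3 / δ ^ 2 ≤ (5 / δ) ^ 2 := by
      rw [div_pow]
      gcongr
      norm_num
    calc (3 / δ ^ 2) ^ (2 * d) ≤ ((5 / δ) ^ 2) ^ (2 * d) := by gcongr
      _ = Real.exp (4 * d * Real.log (5 / δ)) := by
        rw [← pow_mul, ← Real.exp_log (pow_pos hD (2 * (2 * d))), Real.log_pow]
        congr 1
        push_cast
        ring
  have e2 : (M : ℝ) ^ N = Real.exp (N * Real.log M) := by
    rw [Real.exp_nat_mul, Real.exp_log hM0]
  have e3 : (2 : ℝ) = Real.exp (Real.log 2) := (Real.exp_log two_pos).symm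
  have hMN : (2 : ℝ) ≤ M := by
    have : 2 * 1 ≤ N * 2 ^ n := Nat.mul_le_mul hN (Nat.one_le_two_pow)
    rw [hM]
    exact_mod_cast this
  have h2M : Real.log 2 ≤ Real.log M := Real.log_le_log two_pos hMN
  have hL0 : 0 < Real.log 2 := Real.log_pos one_lt_two
  have hN2 : (2 : ℝ) ≤ N := by exact_mod_cast hN
  have hDl : 0 ≤ 2 * d * Real.log (5 / δ) := by
    have : 1 ≤ 5 / δ := by rw [le_div_iff₀ hδ]; linarith
    have := Real.log_nonneg this
    positivity
  have hNT : N * Real.log M / 2 + 2 * d * Real.log (5 / δ) ≤ N * (δ ^ 3 * K / 4) := by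
    refine le_trans (le_of_eq ?_) (mul_le_mul_of_nonneg_left hT hN0.le)
    field_simp
  calc (3 / δ ^ 2) ^ (2 * d) * ((M : ℝ) ^ N * (2 * Real.exp (-(N * K * (20 * δ) ^ 3 / 512))))
      ≤ Real.exp (4 * d * Real.log (5 / δ)) * (Real.exp (N * Real.log M) *
          (Real.exp (Real.log 2) * Real.exp (-(N * K * (20 * δ) ^ 3 / 512)))) := by
        rw [← e2, ← e3]
        gcongr
    _ ≤ Real.exp (-(N * (δ ^ 3 * K / 4))) := by
        rw [← Real.exp_add, ← Real.exp_add, ← Real.exp_add, Real.exp_le_exp]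
        -- With `A = N δ³ K / 4`, the net and the message sets together cost at most `2A`, and the
        -- factor 2 costs at most another `2A`. The exponent `(125/2) A` leaves far more than the
        -- required `A`.
        have h1 : N * K * (20 * δ) ^ 3 / 512 = 125 / 2 * (N * (δ ^ 3 * K / 4)) := by ring
        have h3 : 1 * Real.log M ≤ N * Real.log M := by
          gcongr
          linarith
        rw [h1]
        linarith

/-- With `4 / δ³` factored out of both sides, the comparison is term by term; the contribution `-δ
n` only helps. -/
lemma leakKeyBound_le {d M n : ℕ} {δ : ℝ} (hδ : 0 < δ) (hδ5 : δ < 5) :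
    leakKeyBound d M n δ ≤ 2 ^ n * (1 + 1 / δ) * keyBound d M δ := by
  have hD : 0 < Real.log (5 / δ) := Real.log_pos (by rw [lt_div_iff₀ hδ]; linarith)
  have hL : 0 ≤ Real.log M := Real.log_natCast_nonneg M
  have h2 : (1 : ℝ) ≤ 2 ^ n := one_le_pow₀ one_le_two
  have e : 2 ^ n * (1 + 1 / δ) * keyBound d M δ = 4 / δ ^ 3 * (2 ^ n * ((1 + δ) * Real.log M) +
      2 ^ (n + 1) * (d / M) * Real.log (5 / δ) * (1 + 1 / δ)) := by
    rw [keyBound, pow_succ]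
    rcases Nat.eq_zero_or_pos M with rfl | hM
    · simp
    · field_simp
      ring
  rw [e, leakKeyBound]
  have h3 : 1 * ((1 + δ) * Real.log M) ≤ 2 ^ n * ((1 + δ) * Real.log M) := by gcongr
  have h4 : 2 ^ (n + 1) * (d / M) * Real.log (5 / δ) * 1 ≤
      2 ^ (n + 1) * (d / M) * Real.log (5 / δ) * (1 + 1 / δ) := by
    refine mul_le_mul_of_nonneg_left ?_ (by positivity)
    have : 0 < 1 / δ := by positivity
    linarith
  have h5 : 0 ≤ δ * n := by positivity
  refine mul_le_mul_of_nonneg_left ?_ (by positivity)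
  linarith

/-- The terms in `d` cancel exactly in the difference of `K_n` and `2 ^ n` times the base bound.
What remains is of order `M log M`, over a denominator that is at least `2 d log (5 / δ)`. -/
lemma abs_leakKeyBound_div_sub_one_le {d M n : ℕ} {δ : ℝ} (hd : 0 < d) (hM : 0 < M)
    (hn : 2 ^ n ∣ M) (hδ : 0 < δ) (hδ5 : δ < 5) :
    |leakKeyBound d M n δ / (2 ^ n * keyBound d M δ) - 1| ≤
      (1 + 2 * δ) * (M * Real.log M) / (2 * d * Real.log (5 / δ)) := by
  have hD : 0 < Real.log (5 / δ) := Real.log_pos (by rw [lt_div_iff₀ hδ]; linarith)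
  have hL : 0 ≤ Real.log M := Real.log_natCast_nonneg M
  have h2 : (1 : ℝ) ≤ 2 ^ n := one_le_pow₀ one_le_two
  have hnL : (n : ℝ) ≤ 2 * Real.log M := by
    have := nat_cast_le_log hM hn
    have := Real.log_two_gt_d9
    nlinarith [(Nat.cast_nonneg n : (0 : ℝ) ≤ n)]
  have hM0 : (0 : ℝ) < M := by positivity
  have hd0 : (0 : ℝ) < d := by positivity
  set L := Real.log M
  set D := Real.log (5 / δ)
  have hkey : 0 < δ * L * M + 2 * d * D := by positivity
  have e : leakKeyBound d M n δ / (2 ^ n * keyBound d M δ) - 1 =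
      M * ((L + δ * (L - n) - 2 ^ n * (δ * L)) / 2 ^ n) / (δ * L * M + 2 * d * D) := by
    have e1 : 2 ^ n * keyBound d M δ = 4 / δ ^ 3 * 2 ^ n * ((δ * L * M + 2 * d * D) / M) := by
      change (2 : ℝ) ^ n * (4 / δ ^ 2 * (L + 2 * d / (δ * M) * D)) = _
      field_simp
    have e2 : leakKeyBound d M n δ =
        4 / δ ^ 3 * ((M * (L + δ * (L - n)) + 2 ^ n * 2 * d * D) / M) := by
      change 4 / δ ^ 3 * (L + δ * (L - n) + 2 ^ (n + 1) * (d / M) * D) = _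
      rw [pow_succ (2 : ℝ) n]
      field_simp
    rw [e1, e2]
    field_simp
    ring
  have hnum : |(L + δ * (L - n) - 2 ^ n * (δ * L)) / 2 ^ n| ≤ (1 + 2 * δ) * L := by
    have hδL : 0 ≤ δ * L := by positivity
    have hδn : δ * n ≤ δ * (2 * L) := by gcongr
    have h0 : 0 ≤ δ * n := by positivity
    have h3 : 1 * (δ * L) ≤ 2 ^ n * (δ * L) := by gcongr
    have h4 : 1 * L ≤ 2 ^ n * L := by gcongr
    rw [abs_div, abs_of_pos (by positivity : (0 : ℝ) < 2 ^ n), div_le_iff₀ (by positivity), abs_le]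
    constructor <;> linarith
  rw [e, abs_div, abs_mul, abs_of_pos hM0, abs_of_pos hkey]
  have h5 : 2 * d * D ≤ δ * L * M + 2 * d * D := by
    have : 0 ≤ δ * L * M := by positivity
    linarith
  refine div_le_div₀ (by positivity) ?_ (by positivity) h5
  calc M * |(L + δ * (L - n) - 2 ^ n * (δ * L)) / 2 ^ n| ≤ M * ((1 + 2 * δ) * L) := by gcongr
    _ = (1 + 2 * δ) * (M * L) := by ring

end QDL

/-! ### Assembly. -/

theorem mainTheorem4 :
    -- security: absolute constants `C`, `c`
    (∃ C c : ℝ, 0 < C ∧ 0 < c ∧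
      ∀ (d M K n : ℕ) (δ : ℝ), 0 < d → 0 < M → 0 < K → 2 ^ n ∣ M → 0 < δ →
      ∀ {Ω : Type*} [MeasurableSpace Ω] (μ : Measure Ω) [IsProbabilityMeasure μ]
        (z : Fin M × Fin K × Fin d → Ω → ℂ), QDL.IsPhaseEnsemble μ z →
        (μ (QDL.leakFailure z n (C * (δ * (Real.logb 2 M - n)))) ≤
          ENNReal.ofReal (Real.exp (-((M : ℝ) / 2 ^ n *
            (δ ^ 3 * K / 4 - Real.log M - δ * (Real.log M - n)
              - 2 ^ (n + 1) * (d / M) * Real.log (5 / δ)))))) ∧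
        (QDL.leakKeyBound d M n δ < K →
          μ (QDL.leakFailure z n (C * (δ * (Real.logb 2 M - n)))) ≤
            ENNReal.ofReal (Real.exp (-(c * ((M : ℝ) / 2 ^ n)))))) ∧
    -- the key is enlarged by about `n` bits, i.e. its size `K` by a factor of about `2 ^ n`
    (∀ (d M n : ℕ) (δ : ℝ), 0 < d → 0 < M → 2 ^ n ∣ M → 0 < δ → δ < 5 →
      QDL.leakKeyBound d M n δ ≤ 2 ^ n * (1 + 1 / δ) * QDL.keyBound d M δ ∧
      |QDL.leakKeyBound d M n δ / (2 ^ n * QDL.keyBound d M δ) - 1| ≤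
        (1 + 2 * δ) * (M * Real.log M) / (2 * d * Real.log (5 / δ))) := by
  refine ⟨⟨320, 1 / 4, by norm_num, by norm_num, ?_⟩, fun d M n δ hd hM hn hδ hδ5 =>
    ⟨QDL.leakKeyBound_le hδ hδ5, QDL.abs_leakKeyBound_div_sub_one_le hd hM hn hδ hδ5⟩⟩
  intro d M K n δ hd hM hK hn hδ Ω _ μ _ z hz
  obtain ⟨N, hN⟩ := hn
  rw [mul_comm] at hN
  have hN0 : 0 < N := Nat.pos_of_ne_zero fun h => by simp [h] at hN; omega
  have hMN : (M : ℝ) / 2 ^ n = N := by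
    rw [hN, Nat.cast_mul, Nat.cast_pow, Nat.cast_ofNat, mul_div_cancel_right₀ _ (by positivity)]
  by_cases htriv : N = 1 ∨ 1 ≤ 320 * δ
  · rw [QDL.leakFailure_eq_empty hz hK hd hN hN0 htriv, measure_empty]
    exact ⟨zero_le, fun _ => zero_le⟩
  rw [not_or, not_le] at htriv
  have hN2 : 2 ≤ N := by omega
  have hlow := QDL.half_log_add_le (d := d) hN hN2 hδ htriv.2
  have hbig : ∀ h : Real.log M + δ * (Real.log M - n) + 2 ^ (n + 1) * (d / M) * Real.log (5 / δ) ≤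
      δ ^ 3 * K / 4, μ (QDL.leakFailure z n (320 * (δ * (Real.logb 2 M - n)))) ≤
        ENNReal.ofReal (Real.exp (-(N * (δ ^ 3 * K / 4)))) := fun h =>
    (QDL.measure_leakFailure_le hz hK hd hN hN2 hδ htriv.2).trans
      (ENNReal.ofReal_le_ofReal (QDL.union_bound_le hN hN2 hδ htriv.2 (hlow.trans h)))
  have hD : 0 ≤ Real.log (5 / δ) :=
    Real.log_nonneg (by rw [le_div_iff₀ hδ]; linarith [htriv.2])
  have hlogM : 1 / 2 ≤ Real.log M := by
    have h1 : 2 * 1 ≤ M := hN ▸ Nat.mul_le_mul hN2 Nat.one_le_two_pow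
    have h2 : Real.log 2 ≤ Real.log M := Real.log_le_log two_pos (by exact_mod_cast h1)
    linarith [Real.log_two_gt_d9]
  have hdD : 0 ≤ 2 * d / N * Real.log (5 / δ) := by positivity
  rw [hMN]
  constructor
  -- If the bracket is negative, the bound exceeds 1 and is trivial. Otherwise `hbig` is stronger
  -- than needed, because the subtracted terms have a nonnegative sum.
  · rcases le_total (Real.log M + δ * (Real.log M - n) +
      2 ^ (n + 1) * (d / M) * Real.log (5 / δ)) (δ ^ 3 * K / 4) with h | h
    · refine (hbig h).trans (ENNReal.ofReal_le_ofReal (Real.exp_le_exp.2 (neg_le_neg ?_)))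
      gcongr
      linarith
    · refine prob_le_one.trans ?_
      rw [← ENNReal.ofReal_one]
      refine ENNReal.ofReal_le_ofReal (Real.one_le_exp (neg_nonneg.2 ?_))
      exact mul_nonpos_of_nonneg_of_nonpos (Nat.cast_nonneg N) (by linarith)
  · intro hKn
    have h : Real.log M + δ * (Real.log M - n) + 2 ^ (n + 1) * (d / M) * Real.log (5 / δ) ≤
        δ ^ 3 * K / 4 := by
      rw [QDL.leakKeyBound, div_mul_eq_mul_div, div_lt_iff₀ (by positivity)] at hKn
      linarith
    -- Here `δ³ K / 4 ≥ (log M) / 2 ≥ 1/4`, whence `c = 1/4`.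
    refine (hbig h).trans (ENNReal.ofReal_le_ofReal (Real.exp_le_exp.2 (neg_le_neg ?_)))
    rw [mul_comm]
    gcongr
    linarith
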